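/- A concurrent program is a finite list of threads $S_1,\dots,S_k$, each a nonempty finite sequence of memory operations $\mathtt{r}(x,d)$ (read value $d$ from variable $x$) and $\mathtt{w}(x,d)$ (write value $d$ to variable $x$). An interleaving $\sigma=a_1\cdots a_m$ of the program is an enumeration of all the events (occurrences of operations) of its threads that keeps the order within each thread. It is sequentially consistent if every read $\mathtt{r}(x,d)$ in $\sigma$ is preceded by a write $\mathtt{w}(x,d)$ with no write $\mathtt{w}(x,d')$, $d'\neq d$, in between. A preemption occurs at position $j<m$ if $a_j$ and $a_{j+1}$ belong to different threads and $a_j$ is not the last event of its thread. Let $\mathsf{VSC}^{\pi}$ be the parameterized problem whose instances are pairs $(P,\pi)$ of a concurrent program $P$ and a number $\pi\in\mathbb{N}=\{0,1,2,\dots\}$, with $\pi$ as the parameter, and whose question is whether $P$ has a sequentially consistent interleaving with at most $\pi$ preemptions. A parameterized reduction from a parameterized problem $A$ to a parameterized problem $B$ is a map $(x,k)\mapsto(x',k')$ such that $(x,k)$ is a yes-instance of $A$ if and only if $(x',k')$ is a yes-instance of $B$, $k'\le g(k)$, and $(x',k')$ is computed from $(x,k)$ by a Turing machine within $f(k)\cdot(|x|+1)^{c}$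 steps, for some computable functions $f,g:\mathbb{N}\to\mathbb{N}$ and a constant $c$. The class $\mathrm{W}[1]$ consists of the parameterized problems that have, for some constant $d$, a parameterized reduction to the following problem: given a Boolean circuit of depth at most $d$ in which every path to the output contains at most one gate of fan-in greater than $2$, and given the parameter $k$, is there a satisfying assignment that sets exactly $k$ inputs to true? A parameterized problem is $\mathrm{W}[1]$-hard if every problem in $\mathrm{W}[1]$ has a parameterized reduction to it. **Theorem.** $\mathsf{VSC}^{\pi}$, with $\pi$ part of the input and taken as the parameter, is $\mathrm{W}[1]$-hard. -/

import Mathlib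

namespace ParamComplexity

open Computability Turing

/-! ## Parameterized problems and parameterized reductions -/

/-- A parameterized problem: instances are pairs `(x, k)` of an object `x`, written as a word over a
finite alphabet `Sym`, and a parameter `k : ℕ`. -/
structure ParamProblem where
  /-- the objects -/
  Inst : Type
  /-- the alphabet in which the objects are written -/
  Sym : Type
  /-- the alphabet is finite -/
  symFintype : Fintype Sym
  /-- the encoding of objects by words -/
  enc : Encoding Inst Sym
  /-- `Yes x k`: the pair `(x, k)` is a yes-instance -/
  Yes : Inst → ℕ → Prop

/-- The size `|x|` of an object: the length of its encoding. -/
def ParamProblem.size (A : ParamProblem) (x : A.Inst) : ℕ := (A.enc.encode x).length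

/-- The word given to a machine for the instance `(x, k)`: the parameter in unary (`k` copies of the
extra symbol `none`), followed by the encoding of `x`. -/
def ParamProblem.word (A : ParamProblem) (x : A.Inst) (k : ℕ) : List (Option A.Sym) :=
  List.replicate k none ++ (A.enc.encode x).map some

/-- Parameterized (fpt many-one) reducibility: a map `(x, k) ↦ (x', k')` that preserves and reflects
yes-instances, with `k' ≤ g k`, computed by a multi-stack Turing machine within
`f k * (|x| + 1) ^ c` steps, where `f` and `g` are computable and `c` is a constant. -/
def FPTReducible (A B : ParamProblem) : Prop :=
  ∃ (R : A.Inst → ℕ → B.Inst) (K : A.Inst → ℕ → ℕ) (f g : ℕ → ℕ) (c : ℕ)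
    (M : TM2ComputableAux (Option A.Sym) (Option B.Sym)),
    Computable f ∧ Computable g ∧
    (∀ x k, A.Yes x k ↔ B.Yes (R x k) (K x k)) ∧
    (∀ x k, K x k ≤ g k) ∧
    (∀ x k, Nonempty (TM2OutputsInTime M.tm
      ((A.word x k).map M.inputAlphabet.invFun)
      (some ((B.word (R x k) (K x k)).map M.outputAlphabet.invFun))
      (f k * (A.size x + 1) ^ c)))

/-- Restriction of an encoding to the objects that satisfy `p`. -/
noncomputable def encodingSubtype {α Γ : Type} (e : Encoding α Γ) (p : α → Prop) :
    Encoding {x : α // p x} Γ where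
  encode x := e.encode x.1
  decode w := (e.decode w).bind fun x => open Classical in if h : p x then some ⟨x, h⟩ else none
  decode_encode x := by simp [x.2]

/-! ## Boolean circuits, weft and depth, and the classes `W[t]` -/

/-- Gates of a Boolean circuit; the arguments are numbers of nodes. -/
inductive Gate where
  | neg (i : ℕ)
  | conj (l : List ℕ)
  | disj (l : List ℕ)

/-- The nodes that feed a gate. -/
def Gate.args : Gate → List ℕ
  | .neg i => [i]
  | .conj l => l
  | .disj l => l

/-- Boolean circuits. Nodes `0, …, inputs - 1` are the input nodes, node `inputs + j` is the `j`-th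
gate of the list `gates`, and `out` is the output node. -/
structure Circuit where
  inputs : ℕ
  gates : List Gate
  out : ℕ

namespace Circuit

/-- Every gate is fed by earlier nodes only (so that the circuit is an acyclic directed graph, its
nodes listed in topological order), and the output node exists. -/
def WellFormed (C : Circuit) : Prop :=
  (∀ j g, C.gates[j]? = some g → ∀ i ∈ g.args, i < C.inputs + j) ∧
    C.out < C.inputs + C.gates.length

/-- Given the labels of the input nodes and the rule that computes the label of a gate from the
list of labels of the earlier nodes, the list of the labels of all nodes. -/
def labels {β : Type} (C : Circuit) (step : Gate → List β → β) (init : List β) : List β :=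
  C.gates.foldl (fun vs g => vs ++ [step g vs]) init

/-- The truth value of a gate, from those of the earlier nodes. -/
def gateValue (g : Gate) (vs : List Bool) : Bool :=
  match g with
  | .neg i => !(vs.getD i false)
  | .conj l => l.all fun i => vs.getD i false
  | .disj l => l.any fun i => vs.getD i false

/-- The length of a longest path that ends in a gate. -/
def gateDepth (g : Gate) (ds : List ℕ) : ℕ :=
  (g.args.map fun i => ds.getD i 0).foldr max 0 + 1

/-- The maximal number of large gates, those of fan-in greater than two, on a path that ends in a
gate. -/
def gateWeft (g : Gate) (ws : List ℕ) : ℕ :=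
  (g.args.map fun i => ws.getD i 0).foldr max 0 + if 2 < g.args.length then 1 else 0

/-- The output of the circuit on the assignment `a` of truth values to the input nodes. -/
def eval (C : Circuit) (a : List Bool) : Bool :=
  (C.labels gateValue a).getD C.out false

/-- The depth: the length of a longest path to the output node. -/
def depth (C : Circuit) : ℕ :=
  (C.labels gateDepth (List.replicate C.inputs 0)).getD C.out 0

/-- The weft: the maximal number of large gates on a path to the output node. -/
def weft (C : Circuit) : ℕ :=
  (C.labels gateWeft (List.replicate C.inputs 0)).getD C.out 0

/-- Some assignment that sets exactly `k` input nodes to true satisfies the circuit. -/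
def WeightedSat (C : Circuit) (k : ℕ) : Prop :=
  ∃ a : List Bool, a.length = C.inputs ∧ a.count true = k ∧ C.eval a = true

/-- The symbols with which circuits are written. -/
inductive Sym where
  | one | inp | neg | conj | disj | arg | out
  deriving DecidableEq

instance : Fintype Sym where
  elems := {.one, .inp, .neg, .conj, .disj, .arg, .out}
  complete s := by cases s <;> decide

/-- The word for a gate; node numbers are in unary. -/
def encodeGate : Gate → List Sym
  | .neg i => .neg :: List.replicate i .one
  | .conj l => .conj :: l.flatMap fun i => .arg :: List.replicate i .one
  | .disj l => .disj :: l.flatMap fun i => .arg :: List.replicate i .one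

/-- The word for a circuit: one symbol for each input node, then the gates, then the output. -/
def encode (C : Circuit) : List Sym :=
  List.replicate C.inputs .inp ++
    (C.gates.flatMap encodeGate ++ .out :: List.replicate C.out .one)

/-- State of the decoder, which reads a word from right to left. -/
structure DecState where
  num : ℕ
  args : List ℕ
  circ : Circuit

/-- One step of the decoder. -/
def decStep : Sym → DecState → DecState
  | .one, s => ⟨s.num + 1, s.args, s.circ⟩
  | .arg, s => ⟨0, s.num :: s.args, s.circ⟩
  | .neg, s => ⟨0, [], { s.circ with gates := .neg s.num :: s.circ.gates }⟩
  | .conj, s => ⟨0, [], { s.circ with gates := .conj s.args :: s.circ.gates }⟩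
  | .disj, s => ⟨0, [], { s.circ with gates := .disj s.args :: s.circ.gates }⟩
  | .inp, s => ⟨0, [], { s.circ with inputs := s.circ.inputs + 1 }⟩
  | .out, s => ⟨0, [], { s.circ with out := s.num }⟩

/-- Reading a word from right to left. -/
def decFold (w : List Sym) (s : DecState) : DecState := w.foldr decStep s

theorem decFold_append (u v : List Sym) (s : DecState) :
    decFold (u ++ v) s = decFold u (decFold v s) := by
  simp [decFold]

theorem decFold_cons (a : Sym) (v : List Sym) (s : DecState) :
    decFold (a :: v) s = decStep a (decFold v s) := rfl

theorem decFold_ones (n : ℕ) (s : DecState) :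
    decFold (List.replicate n .one) s = ⟨s.num + n, s.args, s.circ⟩ := by
  induction n with
  | zero => rfl
  | succ n ih => rw [List.replicate_succ, decFold_cons, ih]; rfl

theorem decFold_args (l : List ℕ) (as : List ℕ) (C : Circuit) :
    decFold (l.flatMap fun i => .arg :: List.replicate i .one) ⟨0, as, C⟩ = ⟨0, l ++ as, C⟩ := by
  induction l with
  | nil => rfl
  | cons i l ih =>
    rw [List.flatMap_cons, decFold_append, ih, decFold_cons, decFold_ones]
    simp [decStep]

theorem decFold_gate (g : Gate) (C : Circuit) :
    decFold (encodeGate g) ⟨0, [], C⟩ = ⟨0, [], { C with gates := g :: C.gates }⟩ := by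
  cases g with
  | neg i => simp [encodeGate, decFold_cons, decFold_ones, decStep]
  | conj l => rw [encodeGate, decFold_cons, decFold_args]; simp [decStep]
  | disj l => rw [encodeGate, decFold_cons, decFold_args]; simp [decStep]

theorem decFold_gates (gs : List Gate) (C : Circuit) :
    decFold (gs.flatMap encodeGate) ⟨0, [], C⟩ =
      ⟨0, [], { C with gates := gs ++ C.gates }⟩ := by
  induction gs with
  | nil => rfl
  | cons g gs ih => rw [List.flatMap_cons, decFold_append, ih, decFold_gate]; rfl

theorem decFold_inputs (n : ℕ) (C : Circuit) :
    decFold (List.replicate n .inp) ⟨0, [], C⟩ =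
      ⟨0, [], { C with inputs := C.inputs + n }⟩ := by
  induction n with
  | zero => rfl
  | succ n ih => rw [List.replicate_succ, decFold_cons, ih]; rfl

/-- The encoding of circuits by words. -/
def encoding : Encoding Circuit Sym where
  encode := encode
  decode w := some (decFold w ⟨0, [], ⟨0, [], 0⟩⟩).circ
  decode_encode C := by
    rw [encode, decFold_append, decFold_append, decFold_cons, decFold_ones]
    simp [decStep, decFold_gates, decFold_inputs]

end Circuit

/-- Weighted satisfiability of circuits of weft at most `t` and depth at most `d`: given such a
circuit and the parameter `k`, is there a satisfying assignment of weight exactly `k`? -/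
noncomputable def weightedCircuitSat (t d : ℕ) : ParamProblem where
  Inst := {C : Circuit // C.WellFormed ∧ C.weft ≤ t ∧ C.depth ≤ d}
  Sym := Circuit.Sym
  symFintype := inferInstance
  enc := encodingSubtype Circuit.encoding _
  Yes C k := C.1.WeightedSat k

/-- The class `W[t]`: the parameterized problems that are reducible to weighted satisfiability of
circuits of weft at most `t` and of depth at most `d`, for some constant `d`. -/
def InW (t : ℕ) (A : ParamProblem) : Prop :=
  ∃ d : ℕ, FPTReducible A (weightedCircuitSat t d)

/-- `W[t]`-hardness under parameterized reductions. -/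
def WHard (t : ℕ) (B : ParamProblem) : Prop :=
  ∀ A : ParamProblem, InW t A → FPTReducible A B

/-! ## Sequential consistency with a bounded number of preemptions -/

/-- Memory operations; variables and values are named by natural numbers. -/
inductive Op where
  | read (x d : ℕ)
  | write (x d : ℕ)

/-- A concurrent program: a finite list of nonempty threads; the identifier of a thread is its
position in the list. -/
def Program : Type := {T : List (List Op) // ∀ S ∈ T, S ≠ []}

/-- An event: a thread identifier with a memory operation. -/
abbrev Event : Type := ℕ × Op

namespace Program

/-- The thread with identifier `i`; empty if there is none. -/
def thread (P : Program) (i : ℕ) : List Op := P.1.getD i []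

/-- `σ` is an interleaving of the threads of `P`: for every `i`, the events of `σ` with identifier
`i` are, in order, the operations of the thread `i` (and there are none if there is no thread
`i`). -/
def IsInterleaving (P : Program) (σ : List Event) : Prop :=
  ∀ i, (σ.filter fun e => e.1 == i).map Prod.snd = P.thread i

/-- A preemption of `σ` at position `j`: the events at the positions `j` and `j + 1` belong to
different threads, and the one at `j` is not the last event of its thread. -/
def IsPreemption (P : Program) (σ : List Event) (j : ℕ) : Prop :=
  ∃ e e' : Event, σ[j]? = some e ∧ σ[j + 1]? = some e' ∧ e.1 ≠ e'.1 ∧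
    (σ.take (j + 1)).countP (fun a => a.1 == e.1) < (P.thread e.1).length

/-- The number of preemptions of `σ`. -/
noncomputable def preemptions (P : Program) (σ : List Event) : ℕ :=
  {j | P.IsPreemption σ j}.ncard

end Program

/-- `σ` is sequentially consistent: every read of `d` from `x` is preceded by a write of `d` to `x`,
with no write of another value to `x` in between. -/
def SeqConsistent (σ : List Event) : Prop :=
  ∀ j i x d : ℕ, σ[j]? = some (i, Op.read x d) →
    ∃ m : ℕ, m < j ∧ (∃ i', σ[m]? = some (i', Op.write x d)) ∧
      ∀ l : ℕ, m < l → l < j → ∀ i' d' : ℕ, σ[l]? = some (i', Op.write x d') → d' = d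

namespace Program

/-- The symbols with which programs are written. -/
inductive Sym where
  | one | sep | rd | wr | thr
  deriving DecidableEq

instance : Fintype Sym where
  elems := {.one, .sep, .rd, .wr, .thr}
  complete s := by cases s <;> decide

/-- The word for an operation; names of variables and values are in unary. -/
def encodeOp : Op → List Sym
  | .read x d => .rd :: (List.replicate x .one ++ .sep :: List.replicate d .one)
  | .write x d => .wr :: (List.replicate x .one ++ .sep :: List.replicate d .one)

/-- The word for a list of threads. -/
def encodeThreads (T : List (List Op)) : List Sym :=
  T.flatMap fun S => .thr :: S.flatMap encodeOp

/-- State of the decoder, which reads a word from right to left. -/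
structure DecState where
  num : ℕ
  val : ℕ
  ops : List Op
  threads : List (List Op)

/-- One step of the decoder. -/
def decStep : Sym → DecState → DecState
  | .one, s => ⟨s.num + 1, s.val, s.ops, s.threads⟩
  | .sep, s => ⟨0, s.num, s.ops, s.threads⟩
  | .rd, s => ⟨0, 0, .read s.num s.val :: s.ops, s.threads⟩
  | .wr, s => ⟨0, 0, .write s.num s.val :: s.ops, s.threads⟩
  | .thr, s => ⟨0, 0, [], s.ops :: s.threads⟩

/-- Reading a word from right to left. -/
def decFold (w : List Sym) (s : DecState) : DecState := w.foldr decStep s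

theorem decFold_append (u v : List Sym) (s : DecState) :
    decFold (u ++ v) s = decFold u (decFold v s) := by
  simp [decFold]

theorem decFold_cons (a : Sym) (v : List Sym) (s : DecState) :
    decFold (a :: v) s = decStep a (decFold v s) := rfl

theorem decFold_ones (n : ℕ) (s : DecState) :
    decFold (List.replicate n .one) s = ⟨s.num + n, s.val, s.ops, s.threads⟩ := by
  induction n with
  | zero => rfl
  | succ n ih => rw [List.replicate_succ, decFold_cons, ih]; rfl

theorem decFold_op (o : Op) (ops : List Op) (T : List (List Op)) :
    decFold (encodeOp o) ⟨0, 0, ops, T⟩ = ⟨0, 0, o :: ops, T⟩ := by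
  cases o <;>
    simp [encodeOp, decFold_cons, decFold_append, decFold_ones, decStep]

theorem decFold_ops (S : List Op) (ops : List Op) (T : List (List Op)) :
    decFold (S.flatMap encodeOp) ⟨0, 0, ops, T⟩ = ⟨0, 0, S ++ ops, T⟩ := by
  induction S with
  | nil => rfl
  | cons o S ih => rw [List.flatMap_cons, decFold_append, ih, decFold_op]; rfl

theorem decFold_threads (T : List (List Op)) :
    decFold (encodeThreads T) ⟨0, 0, [], []⟩ = ⟨0, 0, [], T⟩ := by
  induction T with
  | nil => rfl
  | cons S T ih =>
    rw [encodeThreads] at ih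
    rw [encodeThreads, List.flatMap_cons, decFold_append, ih, decFold_cons, decFold_ops]
    simp [decStep]

/-- The encoding of lists of threads by words. -/
def encodingThreads : Encoding (List (List Op)) Sym where
  encode := encodeThreads
  decode w := some (decFold w ⟨0, 0, [], []⟩).threads
  decode_encode T := by rw [decFold_threads]

end Program

/-- The problem of verifying sequential consistency under `π` preemptions, with `π` as the
parameter: given a concurrent program and `π`, is there a sequentially consistent interleaving of
the program with at most `π` preemptions? -/
noncomputable def vsc : ParamProblem where
  Inst := Program
  Sym := Program.Sym
  symFintype := inferInstance
  enc := encodingSubtype Program.encodingThreads _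
  Yes P π := ∃ σ, P.IsInterleaving σ ∧ SeqConsistent σ ∧ P.preemptions σ ≤ π

end ParamComplexity

namespace ParamComplexity

/-! ## Programs without preemptions -/

/-! Weighted circuit satisfiability reduces to the case of no preemptions at all, so the parameter
of the image is constantly `0`. Without preemptions the threads run one after the other, each in one
go, and only their order is free (`vsc_yes_zero_iff`). A thread that first reads and then writes is
therefore a guarded action, and a sequentially consistent interleaving is an ordering of all actions
in which every guard holds when its action comes up.

Such actions evaluate a circuit. One variable is a program counter; each instruction yields one or
two actions guarded by its position. Which of the two actions of an input comes up is the guess of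
its value. Guesses of `true` are counted by separate `slot` actions, one for each value of the
count, so that no action has to depend on both an input and a count. A check action requires that
the program counter is at the end, that the output is true and that the count is `k`; it then raises
a flag, the variable `0`.

The obstacle is that all threads must run, also those of the alternatives not taken. Hence every
action is accompanied by its `release`, which waits for the flag and then makes the guards of the
action true. Before the flag is raised only proper actions can run
(`exists_runAll_of_perm_program`); afterwards everything left over can be discharged
(`exists_perm_program_of_runAll`). With the simulation lemmas `steps_of_runAll` and
`exists_runAll_of_steps` this gives `weightedSat_iff_vsc`.

For the running time, the program can be written in one pass over the unary weight and the word of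
the circuit, with four counters. This is a `Transducer`; `eval_encode` shows that its output is
correct, and `exists_machine_transducer` attaches it to the machine of a given reduction, with a
quadratic time bound. -/

/-- A memory: the current value of each variable, if it has been written. -/
abbrev Mem : Type := ℕ → Option ℕ

/-- Running a sequence of operations on a memory; it fails at a read of a value that is not the
current one. -/
def run : List Op → Mem → Option Mem
  | [], m => some m
  | .read x d :: l, m => if m x = some d then run l m else none
  | .write x d :: l, m => run l (Function.update m x (some d))

/-- The memory after a sequence of operations, reads being ignored. -/
def lastWrites (l : List Op) (m : Mem) : Mem :=
  l.foldl (fun m o => match o with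
    | .read _ _ => m
    | .write x d => Function.update m x (some d)) m

/-! ### Sequential consistency as the success of a run on a memory. -/

theorem run_append (l l' : List Op) (m : Mem) : run (l ++ l') m = (run l m).bind (run l') := by
  induction l generalizing m with
  | nil => rfl
  | cons o l ih =>
    cases o with
    | read x d => by_cases h : m x = some d <;> simp [run, h, ih]
    | write x d => simp [run, ih]

/-- Reads do not change the memory, so as long as `run` has not failed it has the memory computed by
`lastWrites`. -/
theorem exists_run_iff (l : List Op) (m : Mem) :
    (∃ m', run l m = some m') ↔
      ∀ j x d, l[j]? = some (.read x d) → lastWrites (l.take j) m x = some d := by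
  induction l generalizing m with
  | nil => simp [run]
  | cons o l ih =>
    cases o with
    | read x d =>
      by_cases hx : m x = some d
      · simp only [run, hx, if_true, ih]
        constructor
        · rintro h (_ | j) y e he
          · simp only [List.getElem?_cons_zero, Option.some.injEq, Op.read.injEq] at he
            obtain ⟨rfl, rfl⟩ := he
            exact hx
          · exact h j y e he
        · intro h j y e he
          exact h (j + 1) y e he
      · simp only [run, hx, if_false, reduceCtorEq, exists_false, false_iff]
        exact fun h => hx (h 0 x d rfl)
    | write x d =>
      simp only [run, ih]
      constructor
      · rintro h (_ | j) y e he
        · simp at he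
        · exact h j y e he
      · intro h j y e he
        exact h (j + 1) y e he

theorem lastWrites_take_eq_some_iff (l : List Op) (j x d : ℕ) (hj : j ≤ l.length) :
    lastWrites (l.take j) (fun _ => none) x = some d ↔
      ∃ m, m < j ∧ l[m]? = some (.write x d) ∧
        ∀ i, m < i → i < j → ∀ d', l[i]? = some (.write x d') → d' = d := by
  induction j with
  | zero => simp [lastWrites]
  | succ j ih =>
    have hj' : j < l.length := hj
    specialize ih hj'.le
    rw [← List.take_append_getElem hj', lastWrites, List.foldl_append]
    change (match l[j] with
      | .read _ _ => lastWrites (l.take j) (fun _ => none)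
      | .write y e => Function.update (lastWrites (l.take j) (fun _ => none)) y (some e)) x =
        some d ↔ _
    have hget : l[j]? = some l[j] := List.getElem?_eq_getElem hj'
    -- An operation at position `j` that does not write to `x` is neither a possible witness `m` nor
    -- a constraint on the writes after `m`.
    have key : (∀ e, l[j] ≠ .write x e) →
        ((∃ m, m < j + 1 ∧ l[m]? = some (.write x d) ∧
          ∀ i, m < i → i < j + 1 → ∀ d', l[i]? = some (.write x d') → d' = d) ↔
        ∃ m, m < j ∧ l[m]? = some (.write x d) ∧
          ∀ i, m < i → i < j → ∀ d', l[i]? = some (.write x d') → d' = d) := by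
      intro hne
      constructor
      · rintro ⟨m, hm, hw, hall⟩
        refine ⟨m, ?_, hw, fun i hi hij => hall i hi (by omega)⟩
        rcases Nat.lt_succ_iff_lt_or_eq.1 hm with h | rfl
        · exact h
        · rw [hget] at hw
          exact absurd (Option.some.inj hw) (hne d)
      · rintro ⟨m, hm, hw, hall⟩
        refine ⟨m, by omega, hw, fun i hi hij d' hd' => ?_⟩
        rcases Nat.lt_succ_iff_lt_or_eq.1 hij with h | rfl
        · exact hall i hi h d' hd'
        · rw [hget] at hd'
          exact absurd (Option.some.inj hd') (hne d')
    rcases ho : l[j] with ⟨y, e⟩ | ⟨y, e⟩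
    · rw [key (by simp [ho])]
      exact ih
    · by_cases hy : x = y
      · subst hy
        simp only [Function.update_self, Option.some.injEq]
        rw [ho] at hget
        constructor
        · rintro rfl
          exact ⟨j, by omega, hget, fun i h1 h2 => by omega⟩
        · rintro ⟨m, hm, hw, hall⟩
          rcases Nat.lt_succ_iff_lt_or_eq.1 hm with h | rfl
          · exact hall j h (by omega) e hget
          · simpa [hget] using hw
      · rw [key (by rw [ho]; rintro e' ⟨⟩; exact hy rfl)]
        simpa [Function.update_of_ne hy] using ih

/-- The witness in `SeqConsistent` need not be the last write to the variable, but all later writes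
before the read have the same value. So its existence says just that the current value is the one
read. -/
theorem seqConsistent_iff (σ : List Event) :
    SeqConsistent σ ↔ ∃ m, run (σ.map Prod.snd) (fun _ => none) = some m := by
  rw [exists_run_iff]
  have hw : ∀ (m : ℕ) (o : Op), (σ.map Prod.snd)[m]? = some o ↔ ∃ i, σ[m]? = some (i, o) := by
    intro m o
    simp [List.getElem?_map]
  unfold SeqConsistent
  constructor
  · intro h j x d hr
    obtain ⟨i, hi⟩ := (hw _ _).1 hr
    have hj : j ≤ (σ.map Prod.snd).length := by
      have := (List.getElem?_eq_some_iff.1 hr).1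
      omega
    obtain ⟨m, hm, hmw, hall⟩ := h j i x d hi
    refine (lastWrites_take_eq_some_iff _ j x d hj).2
      ⟨m, hm, (hw _ _).2 hmw, fun l h1 h2 d' hd' => ?_⟩
    obtain ⟨i', hi'⟩ := (hw _ _).1 hd'
    exact hall l h1 h2 i' d' hi'
  · intro h j i x d hr
    have hr' := (hw j (.read x d)).2 ⟨i, hr⟩
    have hj : j ≤ (σ.map Prod.snd).length := by
      have := (List.getElem?_eq_some_iff.1 hr').1
      omega
    obtain ⟨m, hm, hmw, hall⟩ := (lastWrites_take_eq_some_iff _ j x d hj).1 (h j x d hr')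
    exact ⟨m, hm, (hw _ _).1 hmw, fun l h1 h2 i₁ d₁ hd => hall l h1 h2 d₁ ((hw _ _).2 ⟨i₁, hd⟩)⟩

/-- The threads, given as a function of the identifier, are not preempted in `σ`. -/
def NoPreemption (th : ℕ → List Op) (σ : List Event) : Prop :=
  ∀ j e e', σ[j]? = some e → σ[j + 1]? = some e' → e.1 ≠ e'.1 →
    (th e.1).length ≤ (σ.take (j + 1)).countP (fun a => a.1 == e.1)

/-! ### Interleavings without preemptions. -/

theorem preemptions_eq_zero_iff (P : Program) (σ : List Event) :
    P.preemptions σ ≤ 0 ↔ NoPreemption P.thread σ := by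
  -- Finiteness matters, because `Set.ncard` is `0` on infinite sets.
  have hfin : {j | P.IsPreemption σ j}.Finite := by
    refine (Set.finite_lt_nat σ.length).subset ?_
    rintro j ⟨e, _, he, _⟩
    exact (List.getElem?_eq_some_iff.1 he).1
  rw [Program.preemptions, Nat.le_zero, Set.ncard_eq_zero hfin, Set.eq_empty_iff_forall_notMem]
  constructor
  · intro h j e e' h1 h2 h3
    by_contra hlt
    exact h j ⟨e, e', h1, h2, h3, not_le.1 hlt⟩
  · rintro h j ⟨e, e', h1, h2, h3, h4⟩
    exact absurd (h j e e' h1 h2 h3) (not_le.2 h4)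

/-- The events of the threads in `L`, each run without interruption. -/
def atomicRun (th : ℕ → List Op) (L : List ℕ) : List Event :=
  L.flatMap fun i => (th i).map (Prod.mk i)

theorem map_snd_atomicRun (th : ℕ → List Op) (L : List ℕ) :
    (atomicRun th L).map Prod.snd = (L.map th).flatten := by
  induction L with
  | nil => rfl
  | cons i L ih =>
    have h : atomicRun th (i :: L) = (th i).map (Prod.mk i) ++ atomicRun th L := by
      simp [atomicRun]
    rw [h, List.map_append, ih]
    simp [Function.comp_def]

theorem filter_atomicRun (th : ℕ → List Op) {L : List ℕ} (hL : L.Nodup) (i : ℕ) :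
    ((atomicRun th L).filter fun e => e.1 == i).map Prod.snd = if i ∈ L then th i else [] := by
  induction L with
  | nil => simp [atomicRun]
  | cons k L ih =>
    have h : atomicRun th (k :: L) = (th k).map (Prod.mk k) ++ atomicRun th L := by
      simp [atomicRun]
    obtain ⟨hk, hL⟩ := List.nodup_cons.1 hL
    rw [h, List.filter_append, List.map_append, ih hL, List.filter_map, List.map_map]
    by_cases hki : k = i
    · subst hki
      simp [Function.comp_def, hk]
    · have hki' : ¬ i = k := fun h => hki h.symm
      simp [Function.comp_def, hki, hki', List.mem_cons]

theorem noPreemption_atomicRun (th : ℕ → List Op) {L : List ℕ} (hL : L.Nodup) :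
    NoPreemption th (atomicRun th L) := by
  induction L with
  | nil => simp [NoPreemption, atomicRun]
  | cons k L ih =>
    have h : atomicRun th (k :: L) = (th k).map (Prod.mk k) ++ atomicRun th L := by
      simp [atomicRun]
    obtain ⟨hk, hL⟩ := List.nodup_cons.1 hL
    intro j e e' h1 h2 hne
    rw [h] at h1 h2 ⊢
    rcases lt_or_ge j (th k).length with hj | hj
    · rw [List.getElem?_append_left (by simpa using hj)] at h1
      simp only [List.getElem?_map, Option.map_eq_some_iff] at h1
      obtain ⟨o, ho, rfl⟩ := h1
      rcases lt_or_ge (j + 1) (th k).length with hj' | hj'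
      · rw [List.getElem?_append_left (by simpa using hj')] at h2
        simp only [List.getElem?_map, Option.map_eq_some_iff] at h2
        obtain ⟨o', ho', rfl⟩ := h2
        exact absurd rfl hne
      · have hlen : j + 1 = ((th k).map (Prod.mk k)).length := by simp; omega
        rw [hlen, List.take_left, List.countP_map]
        simp [Function.comp_def]
    · rw [List.getElem?_append_right (by simpa using hj)] at h1
      rw [List.getElem?_append_right (by simp; omega)] at h2
      simp only [List.length_map] at h1 h2
      rw [show j + 1 - (th k).length = j - (th k).length + 1 by omega] at h2
      have := ih hL _ e e' h1 h2 hne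
      rw [List.take_append, List.countP_append]
      simp only [List.length_map]
      rw [show j + 1 - (th k).length = j - (th k).length + 1 by omega]
      omega

/-- Split off the maximal initial block `B` of events of the first thread. Where the block ends, the
thread must be finished, so `B` is the whole thread, and the rest `D` is shorter. -/
theorem exists_atomicRun {th : ℕ → List Op} {σ : List Event}
    (hσ : ∀ i, (σ.filter fun e => e.1 == i).map Prod.snd = th i) (hp : NoPreemption th σ) :
    ∃ L : List ℕ, L.Nodup ∧ (∀ i, i ∈ L ↔ th i ≠ []) ∧ σ = atomicRun th L := by
  induction hn : σ.length using Nat.strong_induction_on generalizing σ th with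
  | _ n ih =>
  rcases σ with _ | ⟨⟨i, o⟩, τ⟩
  · exact ⟨[], by simp, fun i => by simp [← hσ i], rfl⟩
  · set σ : List Event := (i, o) :: τ with hσdef
    set B := σ.takeWhile fun e => e.1 == i with hB
    set D := σ.dropWhile fun e => e.1 == i with hD
    have hBD : B ++ D = σ := List.takeWhile_append_dropWhile
    have hBi : ∀ e ∈ B, e.1 = i := fun e he => by simpa using List.mem_takeWhile_imp he
    have hBne : B ≠ [] := by simp [hB, hσdef]
    have hBpos : 0 < B.length := List.length_pos_iff.2 hBne
    have hBf : B.filter (fun e => e.1 == i) = B :=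
      List.filter_eq_self.2 fun e he => by simpa using hBi e he
    have hfi : th i = B.map Prod.snd ++ (D.filter fun e => e.1 == i).map Prod.snd := by
      rw [← hσ i, ← hBD, List.filter_append, hBf, List.map_append]
    -- If `D` is nonempty, the last event of `B` is followed by one of another thread. As there is
    -- no preemption, the `B.length` events so far are all those of thread `i`.
    have hDi : D.filter (fun e => e.1 == i) = [] := by
      rcases hDc : D with _ | ⟨e', D'⟩
      · rfl
      · have he' : ¬ e'.1 = i := by
          have := List.head_dropWhile_not (fun e : Event => e.1 == i) (l := σ)
            (by rw [← hD, hDc]; simp)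
          simp only [← hD, hDc] at this
          simpa using this
        have h1 : σ[B.length - 1]? = some (B[B.length - 1]) := by
          rw [← hBD, List.getElem?_append_left (by omega)]
          exact List.getElem?_eq_getElem _
        have h2 : σ[B.length - 1 + 1]? = some e' := by
          rw [← hBD, Nat.sub_add_cancel hBpos, List.getElem?_append_right le_rfl, hDc]
          simp
        have h3 := hBi _ (List.getElem_mem (show B.length - 1 < B.length by omega))
        have h4 := hp _ _ _ h1 h2 (by rw [h3]; exact fun h => he' h.symm)
        rw [h3, Nat.sub_add_cancel hBpos, ← hBD, List.take_left, List.countP_eq_length_filter,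
          hBf, hfi, List.length_append, List.length_map, List.length_map] at h4
        rw [← hDc]
        exact List.eq_nil_of_length_eq_zero (by omega)
    have hDne : ∀ e ∈ D, e.1 ≠ i := by
      intro e he h
      have : e ∈ D.filter (fun e => e.1 == i) := List.mem_filter.2 ⟨he, by simpa using h⟩
      simp [hDi] at this
    have hthi : th i = B.map Prod.snd := by simpa [hDi] using hfi
    have hBeq : B = (th i).map (Prod.mk i) := by
      rw [hthi, List.map_map]
      conv_lhs => rw [← List.map_id B]
      exact List.map_congr_left fun e he => Prod.ext (hBi e he) rfl
    have hlen : B.length + D.length = σ.length := by rw [← hBD, List.length_append]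
    -- In `D` the thread `i` has been used up, so it is replaced by the empty one.
    obtain ⟨L, hnd, hmem, hL⟩ := ih D.length (by omega) (th := Function.update th i []) (σ := D)
      (by
        intro k
        by_cases hk : k = i
        · subst hk
          simp [hDi]
        · rw [Function.update_of_ne hk, ← hσ k, ← hBD, List.filter_append]
          have : B.filter (fun e => e.1 == k) = [] := by
            refine List.filter_eq_nil_iff.2 fun e he => ?_
            simpa [hBi e he] using fun h => hk h.symm
          simp [this])
      (by
        intro j e e' h1 h2 hne
        have hei := hDne e (List.mem_of_getElem? h1)
        rw [Function.update_of_ne hei]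
        have := hp (B.length + j) e e'
          (by rw [← hBD, List.getElem?_append_right (by omega)]; simpa using h1)
          (by
            rw [← hBD, List.getElem?_append_right (by omega), ← h2]
            congr 1; omega) hne
        rw [← hBD, List.take_append, List.countP_append] at this
        have hz : (B.take (B.length + j + 1)).countP (fun a => a.1 == e.1) = 0 := by
          refine List.countP_eq_zero.2 fun a ha => ?_
          simpa [hBi a (List.mem_of_mem_take ha)] using fun h => hei h.symm
        rwa [hz, zero_add, show B.length + j + 1 - B.length = j + 1 by omega] at this)
      rfl
    have hiL : i ∉ L := fun h => by simpa using (hmem i).1 h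
    refine ⟨i :: L, List.nodup_cons.2 ⟨hiL, hnd⟩, fun k => ?_, ?_⟩
    · by_cases hk : k = i
      · subst hk
        simp [hthi, hBne]
      · rw [List.mem_cons, hmem k, Function.update_of_ne hk]
        simp [hk]
    · rw [← hBD, hBeq, hL]
      simp only [atomicRun, List.flatMap_cons]
      congr 1
      refine List.flatMap_congr fun k hk => ?_
      rw [Function.update_of_ne (fun h : k = i => hiL (h ▸ hk))]

/-- The function need not be injective: distinct identifiers may carry equal threads, and a
permutation of the threads still has to be lifted to one of the identifiers. -/
theorem exists_perm_map_eq {α β : Type*} {f : α → β} {l : List β} {l' : List α}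
    (h : l.Perm (l'.map f)) : ∃ k : List α, k.Perm l' ∧ k.map f = l := by
  have h2 : List.Forall₂ (fun b a => f a = b) (l'.map f) l' := by
    rw [List.forall₂_map_left_iff]
    exact List.forall₂_same.2 fun _ _ => rfl
  obtain ⟨k, hk, hp⟩ := List.perm_comp_forall₂ h h2
  refine ⟨k, hp, ?_⟩
  rw [← List.forall₂_eq_eq_eq, List.forall₂_map_left_iff]
  exact hk.flip

/-- Without preemptions, threads run one after the other, each in one go. -/
theorem vsc_yes_zero_iff (P : Program) :
    vsc.Yes P 0 ↔ ∃ L : List (List Op), L.Perm P.1 ∧ ∃ m, run L.flatten (fun _ => none) = some m := by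
  have hmap : (List.range P.1.length).map P.thread = P.1 := by
    refine List.ext_getElem (by simp) fun i h1 h2 => ?_
    simp [Program.thread, List.getD_eq_getElem?_getD, h2]
  have hne : ∀ i, P.thread i ≠ [] ↔ i < P.1.length := by
    intro i
    constructor
    · intro h
      by_contra hi
      exact h (by simp [Program.thread, List.getD_eq_getElem?_getD, not_lt.1 hi])
    · intro hi
      have : P.thread i = P.1[i] := by simp [Program.thread, List.getD_eq_getElem?_getD, hi]
      rw [this]
      exact P.2 _ (List.getElem_mem hi)
  change (∃ σ, P.IsInterleaving σ ∧ SeqConsistent σ ∧ P.preemptions σ ≤ 0) ↔ _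
  constructor
  · rintro ⟨σ, hσ, hsc, hp⟩
    obtain ⟨L, hnd, hmem, rfl⟩ := exists_atomicRun hσ ((preemptions_eq_zero_iff P σ).1 hp)
    refine ⟨L.map P.thread, ?_, ?_⟩
    · conv_rhs => rw [← hmap]
      refine List.Perm.map _ ((List.perm_ext_iff_of_nodup hnd List.nodup_range).2 fun i => ?_)
      rw [hmem, hne, List.mem_range]
    · rwa [seqConsistent_iff, map_snd_atomicRun] at hsc
  · rintro ⟨L, hL, hrun⟩
    obtain ⟨I, hI, rfl⟩ : ∃ I : List ℕ, I.Perm (List.range P.1.length) ∧ I.map P.thread = L := by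
      rw [← hmap] at hL
      exact exists_perm_map_eq hL
    have hnd : I.Nodup := hI.nodup_iff.2 List.nodup_range
    refine ⟨atomicRun P.thread I, fun i => ?_, ?_, ?_⟩
    · rw [filter_atomicRun _ hnd]
      split_ifs with h
      · rfl
      · rw [hI.mem_iff, List.mem_range, ← hne, not_not] at h
        exact h.symm
    · rwa [seqConsistent_iff, map_snd_atomicRun]
    · exact (preemptions_eq_zero_iff _ _).2 (noPreemption_atomicRun _ hnd)

/-! ## Guarded actions -/

/-- A guarded action: if the variables have the values listed in `guards`, it may be carried out,
and performs the assignments listed in `writes`. -/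
structure Action where
  guards : List (ℕ × ℕ)
  writes : List (ℕ × ℕ)

namespace Action

/-- The thread that carries out an action. -/
def thread (a : Action) : List Op :=
  a.guards.map (fun p => .read p.1 p.2) ++ a.writes.map fun p => .write p.1 p.2

/-- Performing a list of assignments. -/
def assign (ws : List (ℕ × ℕ)) (m : Mem) : Mem :=
  ws.foldl (fun m p => Function.update m p.1 (some p.2)) m

/-- The memory satisfies the guards. -/
def Holds (gs : List (ℕ × ℕ)) (m : Mem) : Prop := ∀ p ∈ gs, m p.1 = some p.2

instance (gs : List (ℕ × ℕ)) (m : Mem) : Decidable (Holds gs m) :=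
  inferInstanceAs (Decidable (∀ p ∈ gs, m p.1 = some p.2))

/-- Carrying out a list of actions. -/
def runAll : List Action → Mem → Option Mem
  | [], m => some m
  | a :: L, m => if Holds a.guards m then runAll L (assign a.writes m) else none

/-- All reads precede all writes, so every guard is tested on the memory before the action. -/
theorem run_thread (a : Action) (m : Mem) :
    run a.thread m = if Holds a.guards m then some (assign a.writes m) else none := by
  obtain ⟨gs, ws⟩ := a
  have hw : ∀ m, run (ws.map fun p => .write p.1 p.2) m = some (assign ws m) := by
    induction ws with
    | nil => intro m; rfl
    | cons p ws ih => intro m; exact ih _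
  induction gs with
  | nil => simpa [thread, Holds] using hw m
  | cons p gs ih =>
    have hcons : Holds (p :: gs) m ↔ m p.1 = some p.2 ∧ Holds gs m := by simp [Holds]
    simp only [thread, List.map_cons, List.cons_append, run] at ih ⊢
    by_cases h : m p.1 = some p.2 <;> by_cases h' : Holds gs m <;> simp [h, h', ih, hcons]

theorem run_threads (L : List Action) (m : Mem) :
    run (L.map thread).flatten m = runAll L m := by
  induction L generalizing m with
  | nil => rfl
  | cons a L ih =>
    rw [List.map_cons, List.flatten_cons, run_append, run_thread]
    by_cases h : Holds a.guards m <;> simp [h, runAll, ih]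

theorem runAll_append (L L' : List Action) (m : Mem) :
    runAll (L ++ L') m = (runAll L m).bind (runAll L') := by
  induction L generalizing m with
  | nil => rfl
  | cons a L ih => by_cases h : Holds a.guards m <;> simp [h, runAll, ih]

theorem assign_apply_of_notMem {ws : List (ℕ × ℕ)} {x : ℕ} (h : ∀ p ∈ ws, p.1 ≠ x) (m : Mem) :
    assign ws m x = m x := by
  induction ws generalizing m with
  | nil => rfl
  | cons p ws ih =>
    simp only [List.mem_cons, forall_eq_or_imp] at h
    change assign ws (Function.update m p.1 (some p.2)) x = _
    rw [ih h.2, Function.update_of_ne h.1.symm]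

/-- With a repeated variable, a later assignment could undo an earlier one. -/
theorem holds_assign {gs : List (ℕ × ℕ)} (h : (gs.map Prod.fst).Nodup) (m : Mem) :
    Holds gs (assign gs m) := by
  induction gs generalizing m with
  | nil => simp [Holds]
  | cons p gs ih =>
    rw [List.map_cons, List.nodup_cons] at h
    intro q hq
    rcases List.mem_cons.1 hq with rfl | hq
    · change assign gs (Function.update m q.1 (some q.2)) q.1 = _
      rw [assign_apply_of_notMem, Function.update_self]
      exact fun r hr hrq => h.1 (hrq ▸ List.mem_map_of_mem hr)
    · exact ih h.2 _ q hq

/-- The action that makes the guards of `a` true, once the variable `0` is set to `1`. -/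
def release (a : Action) : Action := ⟨[(0, 1)], a.guards⟩

/-- The actions of a program that first performs the assignments `ws`, then carries out some of the
actions `acts`, and sets the variable `0` to `1` when `gs` holds; after that, all actions that are
left can be carried out. -/
def program (ws gs : List (ℕ × ℕ)) (acts : List Action) : List Action :=
  ⟨[], ws⟩ :: ⟨gs, [(0, 1)]⟩ :: acts.flatMap fun a => [a, a.release]

/-- Soundness. The variable `0` is set by the check action only, and every release waits for it; so
what runs between the initial action and the check action consists of members of `acts`. -/
theorem exists_runAll_of_perm_program {ws gs : List (ℕ × ℕ)} {acts L : List Action}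
    (hws : ∀ p ∈ ws, p.1 ≠ 0) (hgs : gs ≠ []) (hg : ∀ a ∈ acts, a.guards ≠ [])
    (hw : ∀ a ∈ acts, ∀ p ∈ a.writes, p.1 ≠ 0) (hL : L.Perm (program ws gs acts))
    {m : Mem} (hm : runAll L (fun _ => none) = some m) :
    ∃ L', (∀ a ∈ L', a ∈ acts) ∧
      ∃ m', runAll L' (assign ws fun _ => none) = some m' ∧ Holds gs m' := by
  -- `L` is what remains to be run. The invariant is that the variable `0` is unset, and the
  -- induction stops at the check action.
  have key : ∀ (L : List Action) (m₀ m : Mem), m₀ 0 = none → runAll L m₀ = some m →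
      ⟨gs, [(0, 1)]⟩ ∈ L →
      (∀ a ∈ L, a = ⟨gs, [(0, 1)]⟩ ∨ a ∈ acts ∨ ∃ b ∈ acts, a = b.release) →
      ∃ L', (∀ a ∈ L', a ∈ acts) ∧ ∃ m', runAll L' m₀ = some m' ∧ Holds gs m' := by
    intro L
    induction L with
    | nil => simp
    | cons a L ih =>
      intro m₀ m h0 hrun hck hall
      by_cases ha : Holds a.guards m₀
      swap
      · simp [runAll, ha] at hrun
      simp only [runAll, ha, if_true] at hrun
      rcases hall a List.mem_cons_self with rfl | haa | ⟨b, _, rfl⟩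
      · exact ⟨[], by simp, m₀, rfl, ha⟩
      · have hne : (⟨gs, [(0, 1)]⟩ : Action) ≠ a := by
          rintro rfl
          exact hw _ haa (0, 1) (by simp) rfl
        obtain ⟨L', h1, m', h2, h3⟩ := ih _ m
          (by rw [assign_apply_of_notMem (hw a haa), h0]) hrun
          ((List.mem_cons.1 hck).resolve_left hne)
          (fun c hc => hall c (List.mem_cons_of_mem _ hc))
        refine ⟨a :: L', ?_, m', by simp [runAll, ha, h2], h3⟩
        simpa [haa] using h1
      · have := ha (0, 1) (by simp [release])
        simp [h0] at this
  rcases L with _ | ⟨t, L⟩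
  · have := hL.length_eq
    simp [program] at this
  -- The empty memory satisfies no guard, so only the action without guards can come first.
  have ht : t = ⟨[], ws⟩ := by
    have hmem : t ∈ program ws gs acts := hL.mem_iff.1 List.mem_cons_self
    have hno : ∀ gs', gs' ≠ [] → ¬ Holds gs' (fun _ => none) := by
      rintro (_ | ⟨p, gs'⟩) h hh
      · exact h rfl
      · simpa using hh p List.mem_cons_self
    have hnil : t.guards = [] := by
      by_contra h
      simp [runAll, hno _ h] at hm
    simp only [program, List.mem_cons, List.mem_flatMap, List.not_mem_nil, or_false] at hmem
    rcases hmem with rfl | rfl | ⟨a, ha, rfl | rfl⟩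
    · rfl
    · exact absurd hnil hgs
    · exact absurd hnil (hg _ ha)
    · simp [release] at hnil
  subst ht
  have hL' := hL.cons_inv
  refine key L (assign ws fun _ => none) m (assign_apply_of_notMem hws _) ?_
    (hL'.mem_iff.2 List.mem_cons_self) fun a ha => ?_
  · simpa [runAll, Holds] using hm
  · have := hL'.mem_iff.1 ha
    simp only [List.mem_cons, List.mem_flatMap, List.not_mem_nil, or_false] at this
    rcases this with h | ⟨b, hb, rfl | rfl⟩
    · exact .inl h
    · exact .inr (.inl hb)
    · exact .inr (.inr ⟨b, hb, rfl⟩)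

/-- Completeness. Once the variable `0` is `1`, it stays so, since neither the guards, which a
release writes, nor the writes of actions mention it. Hence every release is enabled from then on,
and directly after its release an action is enabled too. -/
theorem exists_perm_program_of_runAll {ws gs : List (ℕ × ℕ)} {acts L : List Action}
    (hg : ∀ a ∈ acts, ∀ p ∈ a.guards, p.1 ≠ 0)
    (hnd : ∀ a ∈ acts, (a.guards.map Prod.fst).Nodup)
    (hw : ∀ a ∈ acts, ∀ p ∈ a.writes, p.1 ≠ 0) (hL : L.Subperm acts)
    {m : Mem} (hm : runAll L (assign ws fun _ => none) = some m) (hgs : Holds gs m) :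
    ∃ L', L'.Perm (program ws gs acts) ∧ ∃ m', runAll L' (fun _ => none) = some m' := by
  obtain ⟨R, hR⟩ : ∃ R, acts.Perm (L ++ R) := by
    obtain ⟨L₀, h₁, h₂⟩ := hL
    obtain ⟨R, hR⟩ := h₂.exists_perm_append
    exact ⟨R, hR.trans (h₁.append_right R)⟩
  have hrel : ∀ (L : List Action) (m : Mem), (∀ a ∈ L, a ∈ acts) → m 0 = some 1 →
      ∃ m', runAll (L.map release) m = some m' ∧ m' 0 = some 1 := by
    intro L
    induction L with
    | nil => exact fun m _ h => ⟨m, rfl, h⟩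
    | cons a L ih =>
      intro m hall h
      simp only [List.mem_cons, forall_eq_or_imp] at hall
      have h1 : Holds (release a).guards m := by simpa [Holds, release] using h
      simp only [List.map_cons, runAll, h1, if_true]
      exact ih _ hall.2 ((assign_apply_of_notMem (hg a hall.1) m).trans h)
  have hboth : ∀ (L : List Action) (m : Mem), (∀ a ∈ L, a ∈ acts) → m 0 = some 1 →
      ∃ m', runAll (L.flatMap fun a => [a.release, a]) m = some m' := by
    intro L
    induction L with
    | nil => exact fun m _ h => ⟨m, rfl⟩
    | cons a L ih =>
      intro m hall h
      simp only [List.mem_cons, forall_eq_or_imp] at hall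
      have h1 : Holds (release a).guards m := by simpa [Holds, release] using h
      have h2 : Holds a.guards (assign (release a).writes m) := holds_assign (hnd a hall.1) m
      simp only [List.flatMap_cons, List.cons_append, List.nil_append, runAll, h1, h2, if_true]
      refine ih _ hall.2 ?_
      rw [assign_apply_of_notMem (hw a hall.1)]
      exact (assign_apply_of_notMem (hg a hall.1) m).trans h
  -- The schedule: the initial action, the given run `L`, the check, the releases of the actions in
  -- `L`, which are merely disposed of, and then each unused action right after its release.
  refine ⟨⟨[], ws⟩ :: (L ++ (⟨gs, [(0, 1)]⟩ ::
    (L.map release ++ R.flatMap fun a => [a.release, a]))), ?_, ?_⟩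
  · refine List.Perm.cons _ (List.perm_middle.trans (List.Perm.cons _ ?_))
    have h1 : (acts.flatMap fun a => [a, a.release]).Perm
        ((L ++ R).flatMap fun a => [a, a.release]) := hR.flatMap_right _
    refine List.Perm.trans ?_ h1.symm
    rw [List.flatMap_append, ← List.append_assoc]
    refine List.Perm.append ?_ ?_
    · clear h1 hR hL hm
      induction L with
      | nil => rfl
      | cons a L ih =>
        simp only [List.map_cons, List.flatMap_cons, List.cons_append, List.nil_append]
        exact (List.perm_middle.trans (List.Perm.cons _ ih)).cons _
    · exact List.Perm.flatMap_left _ fun a _ => List.Perm.swap _ _ _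
  · have h1 : ∀ a ∈ L, a ∈ acts := fun a ha => hL.subset ha
    have h2 : ∀ a ∈ R, a ∈ acts := fun a ha => hR.mem_iff.2 (List.mem_append_right _ ha)
    obtain ⟨m₁, hm₁, h0⟩ := hrel L (assign [(0, 1)] m) h1 (by simp [assign])
    obtain ⟨m₂, hm₂⟩ := hboth R m₁ h2 h0
    refine ⟨m₂, ?_⟩
    have : Holds [] (fun _ => none) := by simp [Holds]
    simp [runAll, this, runAll_append, hm, hgs, hm₁, hm₂]

end Action

/-! ## Evaluation of circuits by guarded actions -/

/-- Instructions for the evaluation of a circuit with guessed inputs: guess the value of a node, set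
the value of a node, and set the value of the node `N` to `b` if that of `A` is `v`. -/
inductive Micro where
  | choose (N : ℕ)
  | set (N : ℕ) (b : Bool)
  | test (A : ℕ) (v : Bool) (N : ℕ) (b : Bool)

namespace Micro

open ParamComplexity.Action

/-- The effect of an instruction on the values of the nodes, and on the number of nodes for which
`true` has been guessed. -/
def Step : Micro → (ℕ → Option Bool) × ℕ → (ℕ → Option Bool) × ℕ → Prop
  | choose N, s, s' => ∃ b : Bool, s' = (Function.update s.1 N (some b), s.2 + b.toNat)
  | set N b, s, s' => s' = (Function.update s.1 N (some b), s.2)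
  | test A v N b, s, s' =>
    ∃ u, s.1 A = some u ∧ s' = (if u = v then Function.update s.1 N (some b) else s.1, s.2)

/-- The effect of a list of instructions. -/
def Steps : List Micro → (ℕ → Option Bool) × ℕ → (ℕ → Option Bool) × ℕ → Prop
  | [], s, s' => s' = s
  | μ :: l, s, s' => ∃ s₁, μ.Step s s₁ ∧ Steps l s₁ s'

theorem steps_append (l l' : List Micro) (s s' : (ℕ → Option Bool) × ℕ) :
    Steps (l ++ l') s s' ↔ ∃ s₁, Steps l s s₁ ∧ Steps l' s₁ s' := by
  induction l generalizing s with
  | nil => simp [Steps]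
  | cons μ l ih =>
    simp only [List.cons_append, Steps, ih]
    constructor
    · rintro ⟨s₁, h1, s₂, h2, h3⟩
      exact ⟨s₂, ⟨s₁, h1, h2⟩, h3⟩
    · rintro ⟨s₂, ⟨s₁, h1, h2⟩, h3⟩
      exact ⟨s₁, h1, s₂, h2, h3⟩

/-- The actions for an instruction. The variable `1` is the program counter, the variable `2` is `1`
if a guess of `true` has not yet been counted, and the variable `N + 4` holds the value of the
node `N`. -/
def acts (t : ℕ) : Micro → List Action
  | choose N => [⟨[(1, t)], [(N + 4, 0), (1, t + 1)]⟩,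
      ⟨[(1, t), (2, 0)], [(N + 4, 1), (2, 1), (1, t + 1)]⟩]
  | set N b => [⟨[(1, t)], [(N + 4, b.toNat), (1, t + 1)]⟩]
  | test A v N b => [⟨[(1, t), (A + 4, v.toNat)], [(N + 4, b.toNat), (1, t + 1)]⟩,
      ⟨[(1, t), (A + 4, (!v).toNat)], [(1, t + 1)]⟩]

/-- The actions for a list of instructions that starts at position `t`. -/
def actsFrom : ℕ → List Micro → List Action
  | _, [] => []
  | t, μ :: l => μ.acts t ++ actsFrom (t + 1) l

/-- The action that counts a guess of `true`, when `j` of them have been counted; the variable `3`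
is the counter. -/
def slot (j : ℕ) : Action := ⟨[(2, 1), (3, j)], [(2, 0), (3, j + 1)]⟩

theorem actsFrom_append (t : ℕ) (l l' : List Micro) :
    actsFrom t (l ++ l') = actsFrom t l ++ actsFrom (t + l.length) l' := by
  induction l generalizing t with
  | nil => rfl
  | cons μ l ih =>
    simp only [List.cons_append, actsFrom, ih, List.append_assoc, List.length_cons]
    rw [show t + 1 + l.length = t + (l.length + 1) by omega]

theorem exists_of_mem_actsFrom {t : ℕ} {l : List Micro} {a : Action} (h : a ∈ actsFrom t l) :
    ∃ (j : ℕ) (μ : Micro), l[j]? = some μ ∧ a ∈ μ.acts (t + j) := by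
  induction l generalizing t with
  | nil => simp [actsFrom] at h
  | cons μ l ih =>
    rcases List.mem_append.1 h with h | h
    · exact ⟨0, μ, rfl, h⟩
    · obtain ⟨j, ν, h1, h2⟩ := ih h
      exact ⟨j + 1, ν, h1, by rwa [show t + (j + 1) = t + 1 + j by omega]⟩

/-- The memory is at position `t`, holds the values `s.1` of the nodes, and has counted the guesses
of `true` up to `τ`. -/
def Agrees (m : Mem) (t : ℕ) (s : (ℕ → Option Bool) × ℕ) (τ : ℕ) : Prop :=
  m 1 = some t ∧ (∀ i, m (i + 4) = (s.1 i).map Bool.toNat) ∧ m 2 = some τ ∧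
    ∃ d, m 3 = some d ∧ d + τ = s.2

theorem map_toNat_update (x : ℕ → Option Bool) (m : Mem) (N : ℕ) (b : Bool)
    (h : ∀ i, m (i + 4) = (x i).map Bool.toNat) (i : ℕ) :
    Function.update m (N + 4) (some b.toNat) (i + 4) =
      (Function.update x N (some b) i).map Bool.toNat := by
  by_cases hi : i = N
  · subst hi; simp
  · rw [Function.update_of_ne hi, Function.update_of_ne (by omega), h]

/-- The guard on the variable `1` ties an enabled action to the current position. The guard on the
variable `2` allows a guess of `true` only if none is waiting to be counted, which keeps `τ ≤ 1`. -/
theorem Agrees.of_acts {m : Mem} {t : ℕ} {s : (ℕ → Option Bool) × ℕ} {τ t' : ℕ} {μ : Micro}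
    {a : Action} (h : Agrees m t s τ) (hτ : τ ≤ 1) (ha : a ∈ μ.acts t') (hg : Holds a.guards m) :
    t' = t ∧ ∃ s' τ', μ.Step s s' ∧ τ' ≤ 1 ∧ Agrees (assign a.writes m) (t + 1) s' τ' := by
  obtain ⟨h1, h2, h3, d, h4, h5⟩ := h
  cases μ with
  | choose N =>
    simp only [acts, List.mem_cons, List.not_mem_nil, or_false] at ha
    rcases ha with rfl | rfl
    · have ht : t' = t := by simpa [Holds, h1, eq_comm] using hg
      subst ht
      refine ⟨rfl, _, τ, ⟨false, rfl⟩, hτ, by simp [assign], fun i => ?_, ?_, d, ?_, ?_⟩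
      · simpa [assign] using map_toNat_update s.1 m N false h2 i
      · simpa [assign] using h3
      · simpa [assign] using h4
      · simpa using h5
    · have ht : t = t' ∧ τ = 0 := by simpa [Holds, h1, h3] using hg
      obtain ⟨rfl, rfl⟩ := ht
      refine ⟨rfl, _, 1, ⟨true, rfl⟩, le_rfl, by simp [assign], fun i => ?_, ?_, d, ?_, ?_⟩
      · simpa [assign] using map_toNat_update s.1 m N true h2 i
      · simp [assign]
      · simpa [assign] using h4
      · simpa using h5
  | set N b =>
    simp only [acts, List.mem_cons, List.not_mem_nil, or_false] at ha
    subst ha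
    have ht : t' = t := by simpa [Holds, h1, eq_comm] using hg
    subst ht
    refine ⟨rfl, _, τ, rfl, hτ, by simp [assign], fun i => ?_, ?_, d, ?_, h5⟩
    · simpa [assign] using map_toNat_update s.1 m N b h2 i
    · simpa [assign] using h3
    · simpa [assign] using h4
  | test A v N b =>
    have hinj : ∀ u w : Bool, u.toNat = w.toNat → u = w := by decide
    simp only [acts, List.mem_cons, List.not_mem_nil, or_false] at ha
    rcases ha with rfl | rfl
    · have ht : t = t' ∧ ∃ u, s.1 A = some u ∧ u.toNat = v.toNat := by
        simpa [Holds, h1, h2] using hg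
      obtain ⟨rfl, u, hu, huv⟩ := ht
      obtain rfl := hinj _ _ huv
      refine ⟨rfl, _, τ, ⟨u, hu, rfl⟩, hτ, by simp [assign], fun i => ?_, ?_, d, ?_, h5⟩
      · simpa [assign] using map_toNat_update s.1 m N b h2 i
      · simpa [assign] using h3
      · simpa [assign] using h4
    · have ht : t = t' ∧ ∃ u, s.1 A = some u ∧ u.toNat = (!v).toNat := by
        simpa [Holds, h1, h2] using hg
      obtain ⟨rfl, u, hu, huv⟩ := ht
      obtain rfl := hinj _ _ huv
      refine ⟨rfl, _, τ, ⟨!v, hu, rfl⟩, hτ, by simp [assign], fun i => ?_, ?_, d, ?_, h5⟩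
      · simpa [assign] using h2 i
      · simpa [assign] using h3
      · simpa [assign] using h4

/-- The invariant is that a prefix of the instructions has been executed. The action of an
instruction prolongs the prefix by one; a slot only moves a pending unit from the variable `2` to
the counter `3`. The final guards say that the prefix is everything, nothing is pending and the
count is `k`. -/
theorem steps_of_runAll {ms : List Micro} {k o : ℕ} {L : List Action} {m : Mem}
    (hL : ∀ a ∈ L, a ∈ (List.range k).map slot ++ actsFrom 0 ms)
    (hm : runAll L (assign [(1, 0), (2, 0), (3, 0)] fun _ => none) = some m)
    (hc : Holds [(1, ms.length), (o + 4, 1), (2, 0), (3, k)] m) :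
    ∃ x, Steps ms (fun _ => none, 0) (x, k) ∧ x o = some true := by
  have key : ∀ (L : List Action) (m₀ : Mem),
      (∀ a ∈ L, a ∈ (List.range k).map slot ++ actsFrom 0 ms) →
      (∃ l s τ, l <+: ms ∧ Steps l (fun _ => none, 0) s ∧ τ ≤ 1 ∧ Agrees m₀ l.length s τ) →
      runAll L m₀ = some m →
      ∃ l s τ, l <+: ms ∧ Steps l (fun _ => none, 0) s ∧ τ ≤ 1 ∧ Agrees m l.length s τ := by
    intro L
    induction L with
    | nil =>
      intro m₀ _ hinv hrun
      obtain rfl : m₀ = m := by simpa [runAll] using hrun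
      exact hinv
    | cons a L ih =>
      intro m₀ hall hinv hrun
      by_cases hg : Holds a.guards m₀
      swap
      · simp [runAll, hg] at hrun
      simp only [runAll, hg, if_true] at hrun
      refine ih _ (fun b hb => hall b (List.mem_cons_of_mem _ hb)) ?_ hrun
      obtain ⟨l, s, τ, hl, hs, hτ, hag⟩ := hinv
      rcases List.mem_append.1 (hall a List.mem_cons_self) with ha | ha
      · obtain ⟨j, -, rfl⟩ := List.mem_map.1 ha
        obtain ⟨h1, h2, h3, d, h4, h5⟩ := hag
        have hh : τ = 1 ∧ d = j := by simpa [Holds, slot, h3, h4] using hg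
        obtain ⟨rfl, rfl⟩ := hh
        refine ⟨l, s, 0, hl, hs, by omega, ?_, fun i => ?_, ?_, d + 1, ?_, h5⟩
        · simpa [slot, assign] using h1
        · simpa [slot, assign] using h2 i
        · simp [slot, assign]
        · simp [slot, assign]
      · obtain ⟨j, μ, hj, ha⟩ := exists_of_mem_actsFrom ha
        rw [zero_add] at ha
        obtain ⟨rfl, s', τ', hst, hτ', hag'⟩ := hag.of_acts hτ ha hg
        refine ⟨l ++ [μ], s', τ', ?_, (steps_append _ _ _ _).2 ⟨s, hs, s', hst, rfl⟩, hτ', ?_⟩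
        · obtain ⟨r, rfl⟩ := hl
          rw [List.getElem?_append_right le_rfl, Nat.sub_self] at hj
          rcases r with _ | ⟨ν, r⟩
          · simp at hj
          · obtain rfl : ν = μ := by simpa using hj
            exact ⟨r, by simp⟩
        · simpa using hag'
  obtain ⟨l, s, τ, hl, hs, -, h1, h2, h3, d, h4, h5⟩ := key L _ hL
    ⟨[], _, 0, List.nil_prefix, rfl, by omega, by simp [assign], fun i => by simp [assign],
      by simp [assign], 0, by simp [assign], rfl⟩ hm
  have hh : l.length = ms.length ∧ (∃ u, s.1 o = some u ∧ u.toNat = 1) ∧ τ = 0 ∧ d = k := by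
    simpa [Holds, h1, h2, h3, h4] using hc
  obtain ⟨hlen, ⟨u, hu, hu1⟩, rfl, rfl⟩ := hh
  obtain rfl := hl.eq_of_length hlen
  refine ⟨s.1, ?_, ?_⟩
  · rw [add_zero] at h5
    rwa [h5]
  · cases u
    · simp at hu1
    · exact hu

/-- Executions grow at the end, hence the reverse induction. Each guess of `true` is counted at
once, so nothing is pending between instructions, and the slots are used once each, in order. -/
theorem exists_runAll_of_steps {ms : List Micro} {s : (ℕ → Option Bool) × ℕ}
    (hs : Steps ms (fun _ => none, 0) s) :
    ∃ L, L.Subperm ((List.range s.2).map slot ++ actsFrom 0 ms) ∧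
      ∃ m, runAll L (assign [(1, 0), (2, 0), (3, 0)] fun _ => none) = some m ∧
        Agrees m ms.length s 0 := by
  induction ms using List.reverseRecOn generalizing s with
  | nil =>
    obtain rfl := hs
    exact ⟨[], List.nil_subperm, _, rfl, by simp [assign], fun i => by simp [assign],
      by simp [assign], 0, by simp [assign], rfl⟩
  | append_singleton ms μ ih =>
    obtain ⟨s₁, h₁, s₂, h₂, h₃⟩ := (steps_append _ _ _ _).1 hs
    obtain rfl : s = s₂ := h₃
    obtain ⟨L, hL, m, hm, hag⟩ := ih h₁
    -- This covers every instruction except a guess of `true`, which takes two actions.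
    have one : ∀ a ∈ μ.acts ms.length, s.2 = s₁.2 → Holds a.guards m →
        Agrees (assign a.writes m) (ms.length + 1) s 0 →
        ∃ L, L.Subperm ((List.range s.2).map slot ++ actsFrom 0 (ms ++ [μ])) ∧
          ∃ m, runAll L (assign [(1, 0), (2, 0), (3, 0)] fun _ => none) = some m ∧
            Agrees m (ms ++ [μ]).length s 0 := by
      intro a ha hs2 hg hag'
      refine ⟨L ++ [a], ?_, assign a.writes m, ?_, by simpa using hag'⟩
      · rw [actsFrom_append, ← List.append_assoc, hs2]
        refine hL.append (List.singleton_subperm_iff.2 ?_)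
        simpa [actsFrom] using ha
      · simp [runAll_append, hm, runAll, hg]
    obtain ⟨h1, h2, h3, d, h4, h5⟩ := hag
    cases μ with
    | choose N =>
      obtain ⟨b, rfl⟩ := h₂
      cases b with
      | false =>
        refine one ⟨[(1, ms.length)], [(N + 4, 0), (1, ms.length + 1)]⟩ (by simp [acts]) (by simp)
          (by simpa [Holds] using h1) ⟨by simp [assign], fun i => ?_, ?_, d, ?_, by simpa using h5⟩
        · simpa [assign] using map_toNat_update s₁.1 m N false h2 i
        · simpa [assign] using h3
        · simpa [assign] using h4
      | true =>
        -- The guess and its slot; the slot is the new last element of the longer range.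
        refine ⟨L ++ [⟨[(1, ms.length), (2, 0)], [(N + 4, 1), (2, 1), (1, ms.length + 1)]⟩,
          slot s₁.2], ?_, assign (slot s₁.2).writes
            (assign [(N + 4, 1), (2, 1), (1, ms.length + 1)] m), ?_, ?_, fun i => ?_, ?_,
            d + 1, ?_, ?_⟩
        · simp only [Bool.toNat_true, List.range_succ, List.map_append, List.map_cons,
            List.map_nil, actsFrom_append, zero_add]
          have hp : ((List.range s₁.2).map slot ++ [slot s₁.2] ++
              (actsFrom 0 ms ++ actsFrom ms.length [choose N])).Perm
              ((List.range s₁.2).map slot ++ actsFrom 0 ms ++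
                (actsFrom ms.length [choose N] ++ [slot s₁.2])) := by
            simp only [List.append_assoc]
            refine List.Perm.append_left _ (List.perm_append_comm.trans ?_)
            simp
          refine List.Subperm.trans ?_ hp.symm.subperm
          refine hL.append (List.Sublist.subperm ?_)
          simp [actsFrom, acts]
        · have hd : d = s₁.2 := by simpa using h5
          have hg : Holds [(1, ms.length), (2, 0)] m := by simp [Holds, h1, h3]
          have hg' : Holds (slot s₁.2).guards
              (assign [(N + 4, 1), (2, 1), (1, ms.length + 1)] m) := by
            simp [Holds, slot, assign, h4, hd]
          simp [runAll_append, hm, runAll, hg, hg']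
        · simp [assign, slot]
        · simpa [assign, slot] using map_toNat_update s₁.1 m N true h2 i
        · simp [assign, slot]
        · have hd : d = s₁.2 := by simpa using h5
          simp [assign, slot, hd]
        · simpa using h5
    | set N b =>
      obtain rfl := h₂
      refine one ⟨[(1, ms.length)], [(N + 4, b.toNat), (1, ms.length + 1)]⟩ (by simp [acts]) rfl
        (by simpa [Holds] using h1) ⟨by simp [assign], fun i => ?_, ?_, d, ?_, h5⟩
      · simpa [assign] using map_toNat_update s₁.1 m N b h2 i
      · simpa [assign] using h3
      · simpa [assign] using h4
    | test A v N b =>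
      obtain ⟨u, hu, rfl⟩ := h₂
      by_cases huv : u = v
      · subst huv
        refine one ⟨[(1, ms.length), (A + 4, u.toNat)], [(N + 4, b.toNat), (1, ms.length + 1)]⟩
          (by simp [acts]) rfl (by simp [Holds, h1, h2, hu])
          ⟨by simp [assign], fun i => ?_, ?_, d, ?_, h5⟩
        · simpa [assign] using map_toNat_update s₁.1 m N b h2 i
        · simpa [assign] using h3
        · simpa [assign] using h4
      · obtain rfl : u = !v := Bool.eq_not.2 huv
        refine one ⟨[(1, ms.length), (A + 4, (!v).toNat)], [(1, ms.length + 1)]⟩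
          (by simp [acts]) rfl (by simp [Holds, h1, h2, hu])
          ⟨by simp [assign], fun i => ?_, ?_, d, ?_, h5⟩
        · simpa [assign] using h2 i
        · simpa [assign] using h3
        · simpa [assign] using h4

end Micro

/-! ### Circuits -/

/-- The value of a gate none of whose arguments has the value `g.trigger`. -/
def Gate.default : Gate → Bool
  | .neg _ => true
  | .conj _ => true
  | .disj _ => false

/-- The value of an argument that makes the value of the gate differ from `g.default`. -/
def Gate.trigger : Gate → Bool
  | .neg _ => true
  | .conj _ => false
  | .disj _ => true

/-- The instructions for the gate `g` at the node `N`. -/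
def Gate.micros (N : ℕ) (g : Gate) : List Micro :=
  .set N g.default :: g.args.map fun i => .test i g.trigger N (!g.default)

/-- The instructions for a list of gates at the nodes `N, N + 1, …`. -/
def gatesMicros : ℕ → List Gate → List Micro
  | _, [] => []
  | N, g :: gs => g.micros N ++ gatesMicros (N + 1) gs

/-- The instructions for a circuit. -/
def Circuit.micros (C : Circuit) : List Micro :=
  (List.range C.inputs).map .choose ++ gatesMicros C.inputs C.gates

/-- One description for all three kinds of gates, so that a gate can be evaluated one argument at a
time: start from the default and flip it when a trigger is met. -/
theorem Circuit.gateValue_eq (g : Gate) (vs : List Bool) :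
    gateValue g vs =
      if g.args.any (fun i => vs.getD i false == g.trigger) then !g.default else g.default := by
  cases g with
  | neg i => cases vs.getD i false <;> simp [gateValue, Gate.args, Gate.trigger, Gate.default]
  | conj l =>
    induction l with
    | nil => rfl
    | cons i l ih =>
      simp only [gateValue, Gate.args, Gate.trigger, Gate.default, List.all_cons, List.any_cons]
        at ih ⊢
      rw [ih]
      have h : ∀ u w : Bool, (u && if w = true then !true else true) =
          if (u == false || w) = true then !true else true := by decide
      exact h _ _
  | disj l =>
    induction l with
    | nil => rfl
    | cons i l ih =>
      simp only [gateValue, Gate.args, Gate.trigger, Gate.default, List.any_cons] at ih ⊢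
      rw [ih]
      have h : ∀ u w : Bool, (u || if w = true then !false else false) =
          if (u == true || w) = true then !false else false := by decide
      exact h _ _

/-- The tests write only to `N`, which is not among the arguments, so the tested values never
change. -/
theorem steps_tests (l : List ℕ) (v : Bool) (N : ℕ) (b : Bool) (f : ℕ → Bool)
    (x : ℕ → Option Bool) (c : ℕ) (hl : ∀ i ∈ l, i ≠ N ∧ x i = some (f i))
    (s' : (ℕ → Option Bool) × ℕ) :
    Micro.Steps (l.map fun i => .test i v N b) (x, c) s' ↔
      s' = (if l.any (fun i => f i == v) then Function.update x N (some b) else x, c) := by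
  induction l generalizing x with
  | nil => simp [Micro.Steps]
  | cons i l ih =>
    simp only [List.mem_cons, forall_eq_or_imp] at hl
    have hstep : ∀ s₁, Micro.Step (.test i v N b) (x, c) s₁ ↔
        s₁ = (if f i = v then Function.update x N (some b) else x, c) := by
      intro s₁
      simp [Micro.Step, hl.1.2]
    simp only [List.map_cons, Micro.Steps, hstep, exists_eq_left]
    by_cases hv : f i = v
    · simp only [hv, if_true, List.any_cons, beq_self_eq_true, Bool.true_or]
      rw [ih]
      · simp
      · exact fun j hj => ⟨(hl.2 j hj).1, by rw [Function.update_of_ne (hl.2 j hj).1, (hl.2 j hj).2]⟩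
    · rw [if_neg hv, ih x hl.2]
      simp [hv]

/-- Nodes are evaluated in order, so the partial assignment is always a list, and setting the next
node appends to it. -/
theorem update_getElem?_length (vs : List Bool) (b : Bool) :
    Function.update (fun i => vs[i]?) vs.length (some b) = fun i => (vs ++ [b])[i]? := by
  funext i
  by_cases hi : i = vs.length
  · subst hi; simp
  · rw [Function.update_of_ne hi]
    rcases lt_or_gt_of_ne hi with h | h
    · rw [List.getElem?_append_left h]
    · rw [List.getElem?_eq_none (by omega), List.getElem?_eq_none (by simp; omega)]

theorem steps_gate (g : Gate) (vs : List Bool) (c : ℕ) (hg : ∀ i ∈ g.args, i < vs.length)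
    (s' : (ℕ → Option Bool) × ℕ) :
    Micro.Steps (g.micros vs.length) (fun i => vs[i]?, c) s' ↔
      s' = (fun i => (vs ++ [Circuit.gateValue g vs])[i]?, c) := by
  simp only [Gate.micros, Micro.Steps, Micro.Step, exists_eq_left]
  rw [steps_tests _ _ _ _ (fun i => vs.getD i false), Circuit.gateValue_eq]
  · rw [update_getElem?_length]
    split_ifs with h
    · rw [← update_getElem?_length, ← update_getElem?_length, Function.update_idem]
    · rfl
  · intro i hi
    have h := hg i hi
    refine ⟨h.ne, ?_⟩
    rw [Function.update_of_ne h.ne, List.getD_eq_getElem?_getD, List.getElem?_eq_getElem h]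
    rfl

theorem steps_gates (gs : List Gate) (vs : List Bool) (c : ℕ)
    (hgs : ∀ j g, gs[j]? = some g → ∀ i ∈ g.args, i < vs.length + j)
    (s' : (ℕ → Option Bool) × ℕ) :
    Micro.Steps (gatesMicros vs.length gs) (fun i => vs[i]?, c) s' ↔
      s' = (fun i => (gs.foldl (fun vs g => vs ++ [Circuit.gateValue g vs]) vs)[i]?, c) := by
  induction gs generalizing vs with
  | nil => simp [gatesMicros, Micro.Steps]
  | cons g gs ih =>
    simp only [gatesMicros, Micro.steps_append, List.foldl_cons]
    have h0 := steps_gate g vs c (fun i hi => hgs 0 g rfl i hi)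
    simp only [h0, exists_eq_left]
    have hlen : vs.length + 1 = (vs ++ [Circuit.gateValue g vs]).length := by simp
    rw [hlen]
    refine ih _ fun j g' hj i hi => ?_
    have := hgs (j + 1) g' hj i hi
    simp
    omega

theorem steps_inputs (n : ℕ) (s : (ℕ → Option Bool) × ℕ) :
    Micro.Steps ((List.range n).map .choose) (fun _ => none, 0) s ↔
      ∃ a : List Bool, a.length = n ∧ s = (fun i => a[i]?, a.count true) := by
  induction n generalizing s with
  | zero => simp [Micro.Steps]
  | succ n ih =>
    simp only [List.range_succ, List.map_append, Micro.steps_append, ih, List.map_cons,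
      List.map_nil, Micro.Steps, Micro.Step]
    constructor
    · rintro ⟨_, ⟨a, rfl, rfl⟩, _, ⟨b, rfl⟩, rfl⟩
      refine ⟨a ++ [b], by simp, ?_⟩
      rw [update_getElem?_length]
      cases b <;> simp
    · rintro ⟨a, ha, rfl⟩
      rcases List.eq_nil_or_concat a with rfl | ⟨a, b, rfl⟩
      · simp at ha
      · simp only [List.concat_eq_append, List.length_append, List.length_singleton,
          Nat.add_right_cancel_iff] at ha
        subst ha
        refine ⟨_, ⟨a, rfl, rfl⟩, _, ⟨b, rfl⟩, ?_⟩
        rw [update_getElem?_length]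
        cases b <;> simp

theorem Circuit.weightedSat_iff_steps {C : Circuit} (hC : C.WellFormed) (k : ℕ) :
    C.WeightedSat k ↔
      ∃ x, Micro.Steps C.micros (fun _ => none, 0) (x, k) ∧ x C.out = some true := by
  have heval : ∀ a : List Bool, C.eval a = true ↔ (C.labels gateValue a)[C.out]? = some true := by
    intro a
    rw [eval, List.getD_eq_getElem?_getD]
    cases (C.labels gateValue a)[C.out]? <;> simp
  simp only [micros, Micro.steps_append, steps_inputs, WeightedSat]
  constructor
  · rintro ⟨a, ha, hk, he⟩
    refine ⟨_, ⟨_, ⟨a, ha, rfl⟩, ?_⟩, (heval a).1 he⟩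
    rw [← ha, steps_gates _ _ _ (by rw [ha]; exact hC.1), hk]
    rfl
  · rintro ⟨x, ⟨_, ⟨a, ha, rfl⟩, hs⟩, hx⟩
    rw [← ha, steps_gates _ _ _ (by rw [ha]; exact hC.1), Prod.mk.injEq] at hs
    obtain ⟨rfl, hk⟩ := hs
    exact ⟨a, ha, hk.symm, (heval a).2 hx⟩

/-! ### The program of a circuit -/

/-- The actions for a circuit and a weight. -/
def Circuit.acts (C : Circuit) (k : ℕ) : List Action :=
  (List.range k).map Micro.slot ++ Micro.actsFrom 0 C.micros

/-- The actions whose threads form the program for a circuit and a weight. -/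
def Circuit.programActions (C : Circuit) (k : ℕ) : List Action :=
  Action.program [(1, 0), (2, 0), (3, 0)]
    -- The list is reversed because the transducer writes from right to left; for the existence of
    -- an ordering this is immaterial.
    [(1, C.micros.length), (C.out + 4, 1), (2, 0), (3, k)] (C.acts k).reverse

theorem Circuit.acts_spec (C : Circuit) (k : ℕ) : ∀ a ∈ C.acts k,
    a.guards ≠ [] ∧ (∀ p ∈ a.guards, p.1 ≠ 0) ∧ (a.guards.map Prod.fst).Nodup ∧
      ∀ p ∈ a.writes, p.1 ≠ 0 := by
  intro a ha
  rcases List.mem_append.1 ha with ha | ha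
  · obtain ⟨j, -, rfl⟩ := List.mem_map.1 ha
    simp [Micro.slot]
  · obtain ⟨j, μ, -, ha⟩ := Micro.exists_of_mem_actsFrom ha
    cases μ <;> simp only [Micro.acts, List.mem_cons, List.not_mem_nil, or_false] at ha
    · rcases ha with rfl | rfl <;> simp
    · subst ha; simp
    · rcases ha with rfl | rfl <;> simp

theorem Circuit.weightedSat_iff_runAll {C : Circuit} (hC : C.WellFormed) (k : ℕ) :
    C.WeightedSat k ↔ ∃ L, L.Perm (C.programActions k) ∧
      ∃ m, Action.runAll L (fun _ => none) = some m := by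
  have hacts := C.acts_spec k
  rw [weightedSat_iff_steps hC]
  constructor
  · rintro ⟨x, hs, hx⟩
    obtain ⟨L, hL, m, hm, h1, h2, h3, d, h4, h5⟩ := Micro.exists_runAll_of_steps hs
    refine Action.exists_perm_program_of_runAll (L := L) (m := m)
      (fun a ha => (hacts a (List.mem_reverse.1 ha)).2.1)
      (fun a ha => (hacts a (List.mem_reverse.1 ha)).2.2.1)
      (fun a ha => (hacts a (List.mem_reverse.1 ha)).2.2.2)
      (hL.trans (List.reverse_perm _).symm.subperm) hm ?_
    have hd : d = k := by simpa using h5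
    simp [Action.Holds, h1, h2, h3, h4, hx, hd]
  · rintro ⟨L, hL, m, hm⟩
    obtain ⟨L', hL', m', hrun, hgs⟩ := Action.exists_runAll_of_perm_program (by simp) (by simp)
      (fun a ha => (hacts a (List.mem_reverse.1 ha)).1)
      (fun a ha => (hacts a (List.mem_reverse.1 ha)).2.2.2) hL hm
    exact Micro.steps_of_runAll (fun a ha => List.mem_reverse.1 (hL' a ha)) hrun hgs

/-- The program for a circuit and a weight. -/
def Circuit.program (C : Circuit) (k : ℕ) : Program :=
  ⟨(C.programActions k).map Action.thread, by
    intro S hS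
    obtain ⟨a, ha, rfl⟩ := List.mem_map.1 hS
    simp only [programActions, Action.program, List.mem_cons, List.mem_flatMap, List.mem_reverse,
      List.not_mem_nil, or_false] at ha
    rcases ha with rfl | rfl | ⟨a, ha, rfl | rfl⟩
    · simp [Action.thread]
    · simp [Action.thread]
    · simp [Action.thread, (C.acts_spec k _ ha).1]
    · simp [Action.thread, Action.release]⟩

theorem Circuit.weightedSat_iff_vsc {C : Circuit} (hC : C.WellFormed) (k : ℕ) :
    C.WeightedSat k ↔ vsc.Yes (C.program k) 0 := by
  rw [vsc_yes_zero_iff, weightedSat_iff_runAll hC]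
  constructor
  · rintro ⟨L, hL, m, hm⟩
    exact ⟨L.map Action.thread, hL.map _, m, by rwa [Action.run_threads]⟩
  · rintro ⟨L, hL, m, hm⟩
    obtain ⟨L', hL', rfl⟩ := exists_perm_map_eq hL
    exact ⟨L', hL', m, by rwa [Action.run_threads] at hm⟩

open Turing StateTransition

/-! ## Machines followed by transducers with counters -/

/-- `f` leads from `a` to `b` in at most `n` steps. -/
def Within {σ : Type*} (f : σ → Option σ) (a b : σ) (n : ℕ) : Prop :=
  Nonempty (EvalsToInTime f a (some b) n)

namespace Within

variable {σ : Type*} {f : σ → Option σ} {a b c : σ} {m n : ℕ}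

theorem refl (f : σ → Option σ) (a : σ) : Within f a a 0 := ⟨EvalsToInTime.refl f a⟩

theorem mono (h : Within f a b m) (hmn : m ≤ n) : Within f a b n := by
  obtain ⟨⟨h, hm⟩⟩ := h
  exact ⟨⟨h, hm.trans hmn⟩⟩

theorem trans (h : Within f a b m) (h' : Within f b c n) : Within f a c (m + n) := by
  obtain ⟨h⟩ := h
  obtain ⟨h'⟩ := h'
  rw [add_comm]
  exact ⟨EvalsToInTime.trans f m n a b _ h h'⟩

theorem head (h : f a = some b) (h' : Within f b c n) : Within f a c (n + 1) := by
  have h1 : Within f a b 1 := ⟨⟨⟨1, h⟩, le_rfl⟩⟩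
  rw [add_comm]
  exact h1.trans h'

theorem map {τ : Type*} {g : τ → Option τ} {φ : σ → τ}
    (hφ : ∀ a b, f a = some b → g (φ a) = some (φ b)) (h : Within f a b n) :
    Within g (φ a) (φ b) n := by
  obtain ⟨⟨⟨s, hs⟩, hn⟩⟩ := h
  refine mono ?_ hn
  clear hn
  induction s generalizing a with
  | zero =>
    obtain rfl : a = b := by simpa using hs
    exact refl _ _
  | succ s ih =>
    rw [Function.iterate_succ_apply] at hs
    cases h : f a with
    | none =>
      -- A run that has stopped does not resume, so all configurations before `b` have a successor.
      have hnone : ∀ s, (flip bind f)^[s] none = none := by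
        intro s
        induction s with
        | zero => rfl
        | succ s ih => rw [Function.iterate_succ_apply]; exact ih
      change (flip bind f)^[s] (f a) = _ at hs
      rw [h, hnone] at hs
      simp at hs
    | some a' =>
      change (flip bind f)^[s] (f a) = _ at hs
      rw [h] at hs
      exact head (hφ _ _ h) (ih hs)

end Within

/-- Instructions of a transducer with counters in `C` and output alphabet `O`: write a symbol, write
a symbol as many times as a counter says, increment a counter, reset a counter. -/
inductive Instr (O C : Type) where
  | put (s : O)
  | putCount (c : C) (s : O)
  | inc (c : C)
  | clear (c : C)

namespace Instr

variable {O C : Type} [DecidableEq C]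

/-- The effect of an instruction on the counters and the output, which is written from right to
left. -/
def eval : Instr O C → (C → ℕ) × List O → (C → ℕ) × List O
  | put s, x => (x.1, s :: x.2)
  | putCount c s, x => (x.1, List.replicate (x.1 c) s ++ x.2)
  | inc c, x => (Function.update x.1 c (x.1 c + 1), x.2)
  | clear c, x => (Function.update x.1 c 0, x.2)

/-- The effect of a list of instructions. -/
def evalAll (l : List (Instr O C)) (x : (C → ℕ) × List O) : (C → ℕ) × List O :=
  l.foldl (fun x i => i.eval x) x

/-- The number of machine steps for an instruction. -/
def cost : Instr O C → (C → ℕ) × List O → ℕ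
  | put _, _ => 1
  | putCount c _, x => 2 * x.1 c + 2
  | inc _, _ => 1
  | clear c, x => x.1 c + 1

/-- The number of machine steps for a list of instructions. -/
def costAll : List (Instr O C) → (C → ℕ) × List O → ℕ
  | [], _ => 0
  | i :: l, x => i.cost x + costAll l (i.eval x)

theorem eval_fst_le (i : Instr O C) {x : (C → ℕ) × List O} {V : ℕ} (h : ∀ c, x.1 c ≤ V) (c : C) :
    (i.eval x).1 c ≤ V + 1 := by
  cases i with
  | put s => exact (h c).trans (Nat.le_succ V)
  | putCount c' s => exact (h c).trans (Nat.le_succ V)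
  | inc c' =>
    by_cases hc : c = c'
    · subst hc
      simpa [eval] using h c
    · simpa [eval, hc] using (h c).trans (Nat.le_succ V)
  | clear c' =>
    by_cases hc : c = c'
    · subst hc
      simp [eval]
    · simpa [eval, hc] using (h c).trans (Nat.le_succ V)

theorem evalAll_fst_le (l : List (Instr O C)) {x : (C → ℕ) × List O} {V : ℕ}
    (h : ∀ c, x.1 c ≤ V) (c : C) : (evalAll l x).1 c ≤ V + l.length := by
  induction l generalizing x V with
  | nil => exact h c
  | cons i l ih =>
    have := ih (eval_fst_le i h)
    rw [List.length_cons]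
    exact this.trans (by omega)

theorem costAll_le (l : List (Instr O C)) {x : (C → ℕ) × List O} {V : ℕ}
    (h : ∀ c, x.1 c ≤ V) : costAll l x ≤ l.length * (2 * (V + l.length) + 2) := by
  induction l generalizing x V with
  | nil => simp [costAll]
  | cons i l ih =>
    have h1 := ih (eval_fst_le i h)
    have h2 : i.cost x ≤ 2 * V + 2 := by
      cases i with
      | put s => simp [cost]
      | putCount c s => simpa [cost] using h c
      | inc c => simp [cost]
      | clear c => have := h c; simp only [cost]; omega
    simp only [costAll, List.length_cons]
    nlinarith

end Instr

/-- A transducer with counters: in the state `q` and for the next symbol `a` of the input, it carries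
out the instructions `block q (some a)` and goes to the state `next q a`; at the end of the input, it
carries out `block q none`. -/
structure Transducer (I O : Type) where
  /-- the states -/
  Q : Type
  /-- there are finitely many states -/
  [finQ : Fintype Q]
  /-- the initial state -/
  start : Q
  /-- the counters -/
  C : Type
  /-- there are finitely many counters -/
  [finC : Fintype C]
  [decC : DecidableEq C]
  next : Q → I → Q
  block : Q → Option I → List (Instr O C)

namespace Transducer

attribute [instance] finQ finC decC

variable {I O : Type} (T : Transducer I O)

/-- The effect of a transducer on the counters and the output. -/
def eval : List I → T.Q → (T.C → ℕ) × List O → (T.C → ℕ) × List O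
  | [], q, x => Instr.evalAll (T.block q none) x
  | a :: w, q, x => eval w (T.next q a) (Instr.evalAll (T.block q (some a)) x)

/-- The number of machine steps of a transducer. -/
def cost : List I → T.Q → (T.C → ℕ) × List O → ℕ
  | [], q, x => Instr.costAll (T.block q none) x + 2
  | a :: w, q, x => Instr.costAll (T.block q (some a)) x + 2 +
      cost w (T.next q a) (Instr.evalAll (T.block q (some a)) x)

/-- An instruction raises a counter by at most one, so over `w.length + 1` blocks the counters stay
below `V + (w.length + 1) * B`, and the cost of an instruction is linear in that. -/
theorem cost_le {B : ℕ} (hB : ∀ q a, (T.block q a).length ≤ B) (w : List I) (q : T.Q)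
    {x : (T.C → ℕ) × List O} {V : ℕ} (h : ∀ c, x.1 c ≤ V) :
    T.cost w q x ≤ (w.length + 1) * (B * (2 * (V + (w.length + 1) * B) + 2) + 2) := by
  have hblock : ∀ q a (x : (T.C → ℕ) × List O) (V : ℕ), (∀ c, x.1 c ≤ V) →
      Instr.costAll (T.block q a) x ≤ B * (2 * (V + B) + 2) := by
    intro q a x V h
    refine (Instr.costAll_le _ h).trans ?_
    have := hB q a
    gcongr
  induction w generalizing q x V with
  | nil =>
    have := hblock q none x V h
    simp only [cost, List.length_nil, zero_add, one_mul]
    omega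
  | cons a w ih =>
    have h1 := hblock q (some a) x V h
    -- The first block may raise the counters to `V + B`; by `h4` the overall bound on them is the
    -- same.
    have h2 := ih (T.next q a) (x := Instr.evalAll (T.block q (some a)) x) (V := V + B)
      (fun c => (Instr.evalAll_fst_le _ h c).trans (by have := hB q (some a); omega))
    simp only [cost, List.length_cons]
    have h3 : V + B ≤ V + (w.length + 1 + 1) * B := by nlinarith
    have h4 : V + B + (w.length + 1) * B = V + (w.length + 1 + 1) * B := by ring
    rw [h4] at h2
    have h5 : B * (2 * (V + B) + 2) ≤ B * (2 * (V + (w.length + 1 + 1) * B) + 2) := by gcongr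
    calc _ ≤ (B * (2 * (V + (w.length + 1 + 1) * B) + 2) + 2) +
        (w.length + 1) * (B * (2 * (V + (w.length + 1 + 1) * B) + 2) + 2) := by omega
      _ = _ := by ring

/-- The labels of the part of the machine that works as the transducer: reading a symbol in a given
state, or carrying out a final segment of a block. -/
abbrev Label : Type :=
  T.Q ⊕ ((Σ p : T.Q × Option I, {l : List (Instr O T.C) // l <:+ T.block p.1 p.2}) × Bool)

/-- The machine must have finitely many labels, and the positions within a block are its suffixes.
-/
noncomputable instance (L : List (Instr O T.C)) : Fintype {l // l <:+ L} := by
  have : Finite {l // l <:+ L} := by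
    refine Set.Finite.to_subtype (s := {l | l <:+ L}) ((List.finite_toSet L.tails).subset ?_)
    exact fun l hl => (List.mem_tails l L).2 hl
  exact Fintype.ofFinite _

section Machine

variable (M : FinTM2)

/-- The stack alphabets of the machine `M` followed by the transducer, which has an output stack,
an auxiliary stack, and a stack for each counter. -/
abbrev stackSym : M.K ⊕ Option (Option T.C) → Type
  | .inl k => M.Γ k
  | .inr none => O
  | .inr (some _) => Unit

/-- The contents of the stacks. -/
def contents (S : ∀ k, List (M.Γ k)) (t : ℕ) (x : (T.C → ℕ) × List O) :
    ∀ k, List (T.stackSym M k)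
  | .inl k => S k
  | .inr none => x.2
  | .inr (some none) => List.replicate t ()
  | .inr (some (some c)) => List.replicate (x.1 c) ()

variable {M}

theorem update_contents_inl (S : ∀ k, List (M.Γ k)) (t : ℕ) (x : (T.C → ℕ) × List O) (k : M.K)
    (w : List (M.Γ k)) :
    Function.update (T.contents M S t x) (.inl k) w = T.contents M (Function.update S k w) t x := by
  funext j
  rcases j with j | _ | _ | c
  · by_cases h : j = k
    · subst h; simp [contents]
    · rw [Function.update_of_ne (by simpa using h)]
      simp [contents, h]
  all_goals rfl

theorem update_contents_out (S : ∀ k, List (M.Γ k)) (t : ℕ) (x : (T.C → ℕ) × List O)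
    (o : List O) :
    Function.update (T.contents M S t x) (.inr none) o = T.contents M S t (x.1, o) := by
  funext j
  rcases j with j | _ | _ | c
  · rfl
  · rw [Function.update_self]; rfl
  all_goals rfl

theorem update_contents_aux (S : ∀ k, List (M.Γ k)) (t : ℕ) (x : (T.C → ℕ) × List O) (t' : ℕ) :
    Function.update (T.contents M S t x) (.inr (some none)) (List.replicate t' ()) =
      T.contents M S t' x := by
  funext j
  rcases j with j | _ | _ | c
  · rfl
  · rfl
  · rw [Function.update_self]; rfl
  · rfl

theorem update_contents_count (S : ∀ k, List (M.Γ k)) (t : ℕ) (x : (T.C → ℕ) × List O) (c : T.C)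
    (n : ℕ) :
    Function.update (T.contents M S t x) (.inr (some (some c))) (List.replicate n ()) =
      T.contents M S t (Function.update x.1 c n, x.2) := by
  funext j
  rcases j with j | _ | _ | c'
  · rfl
  · rfl
  · rfl
  · by_cases h : c' = c
    · subst h
      rw [Function.update_self]; simp [contents]
    · rw [Function.update_of_ne (by simpa using h)]
      simp [contents, h]

variable (M) (e : M.Γ M.k₁ ≃ I)

/-- The internal states of the machine: those of `M`, the symbol read last, and a flag. -/
abbrev State (M : FinTM2) (I : Type) : Type := M.σ × Option I × Bool

/-- A statement of `M` as a statement of the machine `M` followed by the transducer. -/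
def liftStmt : TM2.Stmt M.Γ M.Λ M.σ →
    TM2.Stmt (T.stackSym M) (M.Λ ⊕ T.Label) (State M I)
  | .push k f q => .push (.inl k) (fun v => f v.1) (liftStmt q)
  | .peek k f q => .peek (.inl k) (fun v s => (f v.1 s, v.2)) (liftStmt q)
  | .pop k f q => .pop (.inl k) (fun v s => (f v.1 s, v.2)) (liftStmt q)
  | .load f q => .load (fun v => (f v.1, v.2)) (liftStmt q)
  | .branch f q₁ q₂ => .branch (fun v => f v.1) (liftStmt q₁) (liftStmt q₂)
  | .goto f => .goto fun v => .inl (f v.1)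
  | .halt => .goto fun _ => .inr (.inl T.start)

/-- The statements for a final segment of a block. The flag `loop` is used for the second half of
the instruction `putCount`. -/
def blockStmt (p : T.Q × Option I) (loop : Bool) :
    (l : List (Instr O T.C)) → l <:+ T.block p.1 p.2 →
      TM2.Stmt (T.stackSym M) (M.Λ ⊕ T.Label) (State M I)
  -- The last symbol and the flag are reset, because a halting configuration has to have the initial
  -- internal state.
  | [], _ => .load (fun v => (v.1, none, false)) (match p.2 with
      | none => .halt
      | some a => .goto fun _ => .inr (.inl (T.next p.1 a)))
  | .put s :: l, h => .push (.inr none) (fun _ => s)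
      (.goto fun _ => .inr (.inr (⟨p, l, (List.suffix_cons _ l).trans h⟩, false)))
  | .putCount c s :: l, h => cond loop
      (.pop (.inr (some none)) (fun v u => (v.1, v.2.1, u.isSome))
        (.branch (fun v => v.2.2)
          (.push (.inr (some (some c))) (fun _ => ())
            (.goto fun _ => .inr (.inr (⟨p, .putCount c s :: l, h⟩, true))))
          (.goto fun _ => .inr (.inr (⟨p, l, (List.suffix_cons _ l).trans h⟩, false)))))
      (.pop (.inr (some (some c))) (fun v u => (v.1, v.2.1, u.isSome))
        (.branch (fun v => v.2.2)
          (.push (.inr (some none)) (fun _ => ())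
            (.push (.inr none) (fun _ => s)
              (.goto fun _ => .inr (.inr (⟨p, .putCount c s :: l, h⟩, false)))))
          (.goto fun _ => .inr (.inr (⟨p, .putCount c s :: l, h⟩, true)))))
  | .inc c :: l, h => .push (.inr (some (some c))) (fun _ => ())
      (.goto fun _ => .inr (.inr (⟨p, l, (List.suffix_cons _ l).trans h⟩, false)))
  | .clear c :: l, h => .pop (.inr (some (some c))) (fun v u => (v.1, v.2.1, u.isSome))
      (.branch (fun v => v.2.2)
        (.goto fun _ => .inr (.inr (⟨p, .clear c :: l, h⟩, false)))
        (.goto fun _ => .inr (.inr (⟨p, l, (List.suffix_cons _ l).trans h⟩, false))))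

/-- The statements of the machine `M` followed by the transducer, which reads the output
of `M`. -/
def stmt : M.Λ ⊕ T.Label → TM2.Stmt (T.stackSym M) (M.Λ ⊕ T.Label) (State M I)
  | .inl l => T.liftStmt M (M.m l)
  | .inr (.inl q) => .pop (.inl M.k₁) (fun v s => (v.1, s.map e, false))
      (.goto fun v => .inr (.inr (⟨(q, v.2.1), _, List.suffix_refl _⟩, false)))
  | .inr (.inr (⟨p, l⟩, b)) => T.blockStmt M p b l.1 l.2

/-- The configuration in which the machine carries out a final segment of a block. -/
def blockCfg (p : T.Q × Option I) (l : List (Instr O T.C)) (h : l <:+ T.block p.1 p.2) (b : Bool)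
    (v : State M I) (S : ∀ k, List (M.Γ k)) (t : ℕ) (x : (T.C → ℕ) × List O) :
    TM2.Cfg (T.stackSym M) (M.Λ ⊕ T.Label) (State M I) :=
  ⟨some (.inr (.inr (⟨p, l, h⟩, b))), v, T.contents M S t x⟩

end Machine

/-! ### Simulation of the transducer by the machine. -/

variable (M : FinTM2) (e : M.Γ M.k₁ ≃ I)

/-- A counter is a stack, and reading it destroys it. The first loop moves it to the auxiliary stack
while writing the symbols; the second loop moves it back. -/
theorem within_putCount_fst (p : T.Q × Option I) (c : T.C) (s : O) (l : List (Instr O T.C))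
    (h : (.putCount c s :: l) <:+ T.block p.1 p.2) (v : State M I) (S : ∀ k, List (M.Γ k))
    (t n : ℕ) (x : (T.C → ℕ) × List O) (hn : x.1 c = n) :
    ∃ v' : State M I, v'.1 = v.1 ∧ Within (TM2.step (T.stmt M e))
      (T.blockCfg M p _ h false v S t x)
      (T.blockCfg M p _ h true v' S (t + n)
        (Function.update x.1 c 0, List.replicate n s ++ x.2)) (n + 1) := by
  have hc : T.contents M S t x (.inr (some (some c))) = List.replicate n () := by
    rw [← hn]; rfl
  induction n generalizing v t x with
  | zero =>
    refine ⟨(v.1, v.2.1, false), rfl, Within.head ?_ (Within.refl _ _)⟩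
    have hx : T.contents M S t (Function.update x.1 c 0, x.2) = T.contents M S t x := by
      rw [← hn, Function.update_eq_self]
    simp [blockCfg, TM2.step, stmt, blockStmt, TM2.stepAux, hc, hx]
  | succ n ih =>
    obtain ⟨v', hv', hw⟩ := ih (v.1, v.2.1, true) (t + 1) (Function.update x.1 c n, s :: x.2)
      (by simp) (by simp [contents])
    refine ⟨v', hv', Within.head ?_ (b := T.blockCfg M p _ h false (v.1, v.2.1, true) S (t + 1)
      (Function.update x.1 c n, s :: x.2)) ?_⟩
    · simp only [blockCfg, TM2.step, stmt, blockStmt, TM2.stepAux, hc, cond_false,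
        List.replicate_succ, List.tail_cons, List.head?_cons, Option.isSome_some, cond_true]
      rw [update_contents_count]
      change some (TM2.Cfg.mk _ _ (Function.update (Function.update (T.contents M S t _)
        (.inr (some none)) (List.replicate (t + 1) ())) (.inr none) _)) = _
      rw [update_contents_aux, update_contents_out]
      rfl
    · convert hw using 2
      · omega
      · simp [List.replicate_succ']

theorem within_putCount_snd (p : T.Q × Option I) (c : T.C) (s : O) (l : List (Instr O T.C))
    (h : (.putCount c s :: l) <:+ T.block p.1 p.2) (v : State M I) (S : ∀ k, List (M.Γ k))
    (t : ℕ) (x : (T.C → ℕ) × List O) :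
    ∃ v' : State M I, v'.1 = v.1 ∧ Within (TM2.step (T.stmt M e))
      (T.blockCfg M p _ h true v S t x)
      (T.blockCfg M p l ((List.suffix_cons _ l).trans h) false v' S 0
        (Function.update x.1 c (x.1 c + t), x.2)) (t + 1) := by
  have hc : T.contents M S t x (.inr (some none)) = List.replicate t () := rfl
  induction t generalizing v x with
  | zero =>
    refine ⟨(v.1, v.2.1, false), rfl, Within.head ?_ (Within.refl _ _)⟩
    simp [blockCfg, TM2.step, stmt, blockStmt, TM2.stepAux, hc]
  | succ t ih =>
    obtain ⟨v', hv', hw⟩ := ih (v.1, v.2.1, true) (Function.update x.1 c (x.1 c + 1), x.2) rfl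
    refine ⟨v', hv', Within.head ?_ (b := T.blockCfg M p _ h true (v.1, v.2.1, true) S t
      (Function.update x.1 c (x.1 c + 1), x.2)) ?_⟩
    · simp only [blockCfg, TM2.step, stmt, blockStmt, TM2.stepAux, hc,
        List.replicate_succ, List.tail_cons, List.head?_cons, Option.isSome_some, cond_true]
      rw [update_contents_aux]
      change some (TM2.Cfg.mk _ _ (Function.update (T.contents M S t _)
        (.inr (some (some c))) (List.replicate (x.1 c + 1) ()))) = _
      rw [update_contents_count]
    · simp only [Function.update_self, Function.update_idem] at hw
      rw [show x.1 c + 1 + t = x.1 c + (t + 1) by omega] at hw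
      exact hw

theorem within_clear (p : T.Q × Option I) (c : T.C) (l : List (Instr O T.C))
    (h : (.clear c :: l) <:+ T.block p.1 p.2) (v : State M I) (S : ∀ k, List (M.Γ k))
    (t n : ℕ) (x : (T.C → ℕ) × List O) (hn : x.1 c = n) :
    ∃ v' : State M I, v'.1 = v.1 ∧ Within (TM2.step (T.stmt M e))
      (T.blockCfg M p _ h false v S t x)
      (T.blockCfg M p l ((List.suffix_cons _ l).trans h) false v' S t
        (Function.update x.1 c 0, x.2)) (n + 1) := by
  have hc : T.contents M S t x (.inr (some (some c))) = List.replicate n () := by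
    rw [← hn]; rfl
  induction n generalizing v x with
  | zero =>
    refine ⟨(v.1, v.2.1, false), rfl, Within.head ?_ (Within.refl _ _)⟩
    have hx : T.contents M S t (Function.update x.1 c 0, x.2) = T.contents M S t x := by
      rw [← hn, Function.update_eq_self]
    simp [blockCfg, TM2.step, stmt, blockStmt, TM2.stepAux, hc, hx]
  | succ n ih =>
    obtain ⟨v', hv', hw⟩ := ih (v.1, v.2.1, true) (Function.update x.1 c n, x.2)
      (by simp) (by simp [contents])
    refine ⟨v', hv', Within.head ?_ (b := T.blockCfg M p _ h false (v.1, v.2.1, true) S t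
      (Function.update x.1 c n, x.2)) ?_⟩
    · simp only [blockCfg, TM2.step, stmt, blockStmt, TM2.stepAux, hc,
        List.replicate_succ, List.tail_cons, List.head?_cons, Option.isSome_some, cond_true]
      rw [update_contents_count]
    · simpa using hw

theorem within_instr (p : T.Q × Option I) (i : Instr O T.C) (l : List (Instr O T.C))
    (h : (i :: l) <:+ T.block p.1 p.2) (v : State M I) (S : ∀ k, List (M.Γ k))
    (x : (T.C → ℕ) × List O) :
    ∃ v' : State M I, v'.1 = v.1 ∧ Within (TM2.step (T.stmt M e))
      (T.blockCfg M p _ h false v S 0 x)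
      (T.blockCfg M p l ((List.suffix_cons _ l).trans h) false v' S 0 (i.eval x)) (i.cost x) := by
  cases i with
  | put s =>
    refine ⟨v, rfl, Within.head ?_ (Within.refl _ _)⟩
    simp only [blockCfg, TM2.step, stmt, blockStmt, TM2.stepAux, update_contents_out]
    rfl
  | inc c =>
    refine ⟨v, rfl, Within.head ?_ (Within.refl _ _)⟩
    change some (TM2.Cfg.mk _ _ (Function.update (T.contents M S 0 x)
        (.inr (some (some c))) (List.replicate (x.1 c + 1) ()))) = _
    rw [update_contents_count]
    rfl
  | clear c => exact T.within_clear M e p c l h v S 0 _ x rfl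
  | putCount c s =>
    obtain ⟨v₁, hv₁, h₁⟩ := T.within_putCount_fst M e p c s l h v S 0 _ x rfl
    obtain ⟨v₂, hv₂, h₂⟩ := T.within_putCount_snd M e p c s l h v₁ S (0 + x.1 c)
      (Function.update x.1 c 0, List.replicate (x.1 c) s ++ x.2)
    refine ⟨v₂, hv₂.trans hv₁, ?_⟩
    simp only [zero_add, Function.update_self, Function.update_idem, Function.update_eq_self]
      at h₁ h₂
    exact (h₁.trans h₂).mono (by simp only [Instr.cost]; omega)

theorem within_block (p : T.Q × Option I) (l : List (Instr O T.C))
    (h : l <:+ T.block p.1 p.2) (v : State M I) (S : ∀ k, List (M.Γ k))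
    (x : (T.C → ℕ) × List O) :
    ∃ v' : State M I, v'.1 = v.1 ∧ Within (TM2.step (T.stmt M e))
      (T.blockCfg M p l h false v S 0 x)
      (T.blockCfg M p [] List.nil_suffix false v' S 0 (Instr.evalAll l x))
      (Instr.costAll l x) := by
  induction l generalizing v x with
  | nil => exact ⟨v, rfl, Within.refl _ _⟩
  | cons i l ih =>
    obtain ⟨v₁, hv₁, h₁⟩ := T.within_instr M e p i l h v S x
    obtain ⟨v₂, hv₂, h₂⟩ := ih ((List.suffix_cons _ l).trans h) v₁ (i.eval x)
    exact ⟨v₂, hv₂.trans hv₁, h₁.trans h₂⟩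

theorem step_read (q : T.Q) (v : State M I) (S : ∀ k, List (M.Γ k)) (x : (T.C → ℕ) × List O) :
    TM2.step (T.stmt M e) ⟨some (.inr (.inl q)), v, T.contents M S 0 x⟩ =
      some (T.blockCfg M (q, (S M.k₁).head?.map e) _ (List.suffix_refl _) false
        (v.1, (S M.k₁).head?.map e, false) (Function.update S M.k₁ (S M.k₁).tail) 0 x) := by
  rw [blockCfg, ← update_contents_inl]
  rfl

theorem within_transducer (w : List I) (q : T.Q) (v : M.σ) (x : (T.C → ℕ) × List O) :
    Within (TM2.step (T.stmt M e))
      ⟨some (.inr (.inl q)), (v, none, false),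
        T.contents M (Function.update (fun _ => []) M.k₁ (w.map e.symm)) 0 x⟩
      ⟨none, (v, none, false), T.contents M (fun _ => []) 0 (T.eval w q x)⟩ (T.cost w q x) := by
  induction w generalizing q x with
  | nil =>
    obtain ⟨v', hv', h⟩ := T.within_block M e (q, none) _ (List.suffix_refl _)
      (v, none, false) (fun _ => []) x
    refine (Within.head ?_ (h.trans (Within.head ?_ (Within.refl _ _)))).mono
      (show _ + (0 + 1) + 1 ≤ _ from le_rfl)
    · rw [step_read]
      simp only [List.map_nil, Function.update_self, List.head?_nil, Option.map_none,
        List.tail_nil, Function.update_eq_self]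
    · obtain ⟨v₁, v₂⟩ := v'
      obtain rfl : v₁ = v := hv'
      rfl
  | cons a w ih =>
    obtain ⟨v', hv', h⟩ := T.within_block M e (q, some a) _ (List.suffix_refl _)
      (v, some a, false) (Function.update (fun _ => []) M.k₁ (w.map e.symm)) x
    refine (Within.head ?_ (h.trans (Within.head ?_ (ih _ _)))).mono ?_
    · rw [step_read]
      simp only [List.map_cons, Function.update_self, List.head?_cons, Option.map_some,
        List.tail_cons, Function.update_idem, Equiv.apply_symm_apply]
    · obtain ⟨v₁, v₂⟩ := v'
      obtain rfl : v₁ = v := hv'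
      rfl
    · simp only [cost]
      omega

/-- A configuration of `M` as a configuration of `M` followed by the transducer. -/
def liftCfg (c : TM2.Cfg M.Γ M.Λ M.σ) : TM2.Cfg (T.stackSym M) (M.Λ ⊕ T.Label) (State M I) :=
  ⟨some (match c.l with
    | none => .inr (.inl T.start)
    | some l => .inl l), (c.var, none, false), T.contents M c.stk 0 (fun _ => 0, [])⟩

theorem stepAux_liftStmt (q : TM2.Stmt M.Γ M.Λ M.σ) (v : M.σ) (S : ∀ k, List (M.Γ k)) :
    TM2.stepAux (T.liftStmt M q) (v, none, false) (T.contents M S 0 (fun _ => 0, [])) =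
      T.liftCfg M (TM2.stepAux q v S) := by
  induction q generalizing v S with
  | push k f q ih => simp only [liftStmt, TM2.stepAux, update_contents_inl]; exact ih _ _
  | peek k f q ih => exact ih _ _
  | pop k f q ih => simp only [liftStmt, TM2.stepAux, update_contents_inl]; exact ih _ _
  | load f q ih => exact ih _ _
  | branch f q₁ q₂ ih₁ ih₂ =>
    simp only [liftStmt, TM2.stepAux]
    cases f v
    · exact ih₂ _ _
    · exact ih₁ _ _
  | goto f => rfl
  | halt => rfl

theorem step_liftCfg (c c' : TM2.Cfg M.Γ M.Λ M.σ) (h : TM2.step M.m c = some c') :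
    TM2.step (T.stmt M e) (T.liftCfg M c) = some (T.liftCfg M c') := by
  obtain ⟨_ | l, v, S⟩ := c
  · simp [TM2.step] at h
  · obtain rfl : TM2.stepAux (M.m l) v S = c' := by simpa [TM2.step] using h
    exact congrArg some (T.stepAux_liftStmt M (M.m l) v S)

/-- The machine `M` followed by the transducer. -/
noncomputable def machine [Fintype I] : FinTM2 where
  K := M.K ⊕ Option (Option T.C)
  kFin := by
    have := M.kFin
    infer_instance
  k₀ := .inl M.k₀
  k₁ := .inr none
  Γ := T.stackSym M
  Λ := M.Λ ⊕ T.Label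
  main := .inl M.main
  ΛFin := by
    have := M.ΛFin
    infer_instance
  σ := State M I
  initialState := (M.initialState, none, false)
  σFin := by
    have := M.σFin
    infer_instance
  Γk₀Fin := M.Γk₀Fin
  m := T.stmt M e

end Transducer

/-! ### Output length and composition with a transducer. -/

theorem initList_stk (M : FinTM2) (w : List (M.Γ M.k₀)) :
    (initList M w).stk = Function.update (fun _ => []) M.k₀ w := by
  funext k
  by_cases h : k = M.k₀
  · subst h; simp [initList]
  · simp [initList, h]

theorem haltList_stk (M : FinTM2) (w : List (M.Γ M.k₁)) :
    (haltList M w).stk = Function.update (fun _ => []) M.k₁ w := by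
  funext k
  by_cases h : k = M.k₁
  · subst h; simp [haltList]
  · simp [haltList, h]

/-- The maximal number of symbols that a statement pushes. -/
def pushes {K : Type} {Γ : K → Type} {Λ σ : Type} : TM2.Stmt Γ Λ σ → ℕ
  | .push _ _ q => pushes q + 1
  | .peek _ _ q => pushes q
  | .pop _ _ q => pushes q
  | .load _ q => pushes q
  | .branch _ q₁ q₂ => max (pushes q₁) (pushes q₂)
  | .goto _ => 0
  | .halt => 0

theorem length_stepAux_le {K : Type} [DecidableEq K] {Γ : K → Type} {Λ σ : Type}
    (q : TM2.Stmt Γ Λ σ) (v : σ) (S : ∀ k, List (Γ k)) (k : K) :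
    ((TM2.stepAux q v S).stk k).length ≤ (S k).length + pushes q := by
  induction q generalizing v S with
  | push k' f q ih =>
    refine (ih _ _).trans ?_
    by_cases h : k = k'
    · subst h; simp [pushes]; omega
    · simp [pushes, h]
  | peek k' f q ih => exact ih _ _
  | pop k' f q ih =>
    refine (ih _ _).trans ?_
    by_cases h : k = k'
    · subst h; simp [pushes]
    · simp [pushes, h]
  | load f q ih => exact ih _ _
  | branch f q₁ q₂ ih₁ ih₂ =>
    simp only [TM2.stepAux, pushes]
    cases f v
    · exact (ih₂ _ _).trans (by simp)
    · exact (ih₁ _ _).trans (by simp)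
  | goto f => simp [TM2.stepAux]
  | halt => simp [TM2.stepAux]

/-- The transducer's time depends on the length of its input, which is the output of `M`; this
output is bounded through the time of `M`, as one step pushes boundedly many symbols. -/
theorem length_output_le (M : FinTM2) : ∃ D, ∀ (u : List (M.Γ M.k₀)) (w : List (M.Γ M.k₁)) (n : ℕ),
    Nonempty (TM2OutputsInTime M u (some w) n) → w.length ≤ u.length + D * n := by
  have := M.ΛFin
  obtain ⟨D, hD⟩ : ∃ D, ∀ l, pushes (M.m l) ≤ D :=
    ⟨Finset.univ.sup fun l => pushes (M.m l),
      fun l => Finset.le_sup (f := fun l => pushes (M.m l)) (Finset.mem_univ l)⟩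
  refine ⟨D, ?_⟩
  rintro u w n ⟨⟨⟨s, hs⟩, hn⟩⟩
  have key : ∀ (s : ℕ) (c c' : M.Cfg) (k : M.K), (flip bind M.step)^[s] (some c) = some c' →
      (c'.stk k).length ≤ (c.stk k).length + D * s := by
    intro s
    induction s with
    | zero =>
      intro c c' k h
      obtain rfl : c = c' := by simpa using h
      simp
    | succ s ih =>
      intro c c' k h
      rw [Function.iterate_succ_apply'] at h
      obtain ⟨c₁, h₁, h₂⟩ := Option.bind_eq_some_iff.1 h
      have h₃ := ih c c₁ k h₁
      obtain ⟨_ | l, v, S⟩ := c₁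
      · simp [TM2.step] at h₂
      · obtain rfl : TM2.stepAux (M.m l) v S = c' := Option.some.inj h₂
        have h₄ := length_stepAux_le (M.m l) v S k
        have h₅ := hD l
        have h₆ : (S k).length ≤ (c.stk k).length + D * s := h₃
        rw [Nat.mul_succ]
        omega
  have h1 := key s _ _ M.k₁ hs
  have h2 : ∀ k, ((initList M u).stk k).length ≤ u.length := by
    intro k
    rw [initList_stk]
    by_cases h : k = M.k₀
    · subst h; simp
    · simp [h]
  specialize h2 M.k₁
  rw [haltList_stk, Function.update_self] at h1
  have h3 : D * s ≤ D * n := Nat.mul_le_mul_left _ hn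
  omega

/-- A machine followed by a transducer. -/
theorem exists_machine_transducer {Γ₀ I O : Type} [Fintype I] (M : TM2ComputableAux Γ₀ I)
    (T : Transducer I O) :
    ∃ (M' : TM2ComputableAux Γ₀ O) (D : ℕ), ∀ (u : List Γ₀) (w : List I) (o : List O) (n : ℕ),
      Nonempty (TM2OutputsInTime M.tm (u.map M.inputAlphabet.invFun)
        (some (w.map M.outputAlphabet.invFun)) n) →
      T.eval w T.start (fun _ => 0, []) = (fun _ => 0, o) →
      Nonempty (TM2OutputsInTime M'.tm (u.map M'.inputAlphabet.invFun)
        (some (o.map M'.outputAlphabet.invFun)) (D * (u.length + n + 1) ^ 2)) := by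
  obtain ⟨D₁, hD₁⟩ := length_output_le M.tm
  obtain ⟨B, hB⟩ : ∃ B, ∀ q a, (T.block q a).length ≤ B :=
    ⟨Finset.univ.sup fun p : T.Q × Option I => (T.block p.1 p.2).length, fun q a =>
      Finset.le_sup (f := fun p : T.Q × Option I => (T.block p.1 p.2).length)
        (Finset.mem_univ (q, a))⟩
  -- The summand `1` pays for the run of `M`. The rest bounds the cost of the transducer, quadratic
  -- in `w.length + 1`, which is at most `(1 + D₁) * (u.length + n + 1)`.
  refine ⟨⟨T.machine M.tm M.outputAlphabet, M.inputAlphabet, Equiv.refl _⟩,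
    1 + (2 * B * B + 2 * B + 2) * (1 + D₁) ^ 2, fun u w o n hn ho => ?_⟩
  have hlen : w.length ≤ u.length + D₁ * n := by simpa using hD₁ _ _ _ hn
  have h₁ : Within (TM2.step (T.stmt M.tm M.outputAlphabet))
      (T.liftCfg M.tm (initList M.tm (u.map M.inputAlphabet.invFun)))
      (T.liftCfg M.tm (haltList M.tm (w.map M.outputAlphabet.invFun))) n :=
    Within.map (f := TM2.step M.tm.m) (T.step_liftCfg M.tm M.outputAlphabet) hn
  have h₂ := T.within_transducer M.tm M.outputAlphabet w T.start M.tm.initialState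
    (fun _ => 0, [])
  have hcost := T.cost_le hB w T.start (x := (fun _ => 0, [])) (V := 0) (fun _ => le_rfl)
  have hmid : T.liftCfg M.tm (haltList M.tm (w.map M.outputAlphabet.invFun)) =
      ⟨some (.inr (.inl T.start)), (M.tm.initialState, none, false),
        T.contents M.tm (Function.update (fun _ => []) M.tm.k₁ (w.map M.outputAlphabet.symm)) 0
          (fun _ => 0, [])⟩ := by
    simp only [Transducer.liftCfg, haltList_stk]
    rfl
  rw [hmid] at h₁
  have h₃ := (h₁.trans h₂).mono (n := (1 + (2 * B * B + 2 * B + 2) * (1 + D₁) ^ 2) *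
    (u.length + n + 1) ^ 2) (by
      have hw : w.length + 1 ≤ (1 + D₁) * (u.length + n + 1) := by nlinarith
      have hc : T.cost w T.start (fun _ => 0, []) ≤
          (2 * B * B + 2 * B + 2) * (w.length + 1) ^ 2 := by
        refine hcost.trans ?_
        nlinarith [Nat.zero_le (B * w.length), Nat.zero_le (w.length * w.length),
          Nat.zero_le (B * (w.length * w.length))]
      have hc' : (w.length + 1) ^ 2 ≤ (1 + D₁) ^ 2 * (u.length + n + 1) ^ 2 := by
        rw [← mul_pow]
        exact Nat.pow_le_pow_left hw 2
      have hn' : n ≤ (u.length + n + 1) ^ 2 := by nlinarith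
      calc _ ≤ (u.length + n + 1) ^ 2 + (2 * B * B + 2 * B + 2) *
          ((1 + D₁) ^ 2 * (u.length + n + 1) ^ 2) :=
            add_le_add hn' (hc.trans (Nat.mul_le_mul_left _ hc'))
        _ = _ := by ring)
  rw [ho] at h₃
  have hempty : T.contents M.tm (fun _ => []) 0 (fun _ => 0, []) = fun _ => [] := by
    funext k
    rcases k with _ | _ | _ | _ <;> rfl
  have hinit : T.liftCfg M.tm (initList M.tm (u.map M.inputAlphabet.invFun)) =
      initList (T.machine M.tm M.outputAlphabet) (u.map M.inputAlphabet.invFun) := by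
    have hs : T.contents M.tm (initList M.tm (u.map M.inputAlphabet.invFun)).stk 0
        (fun _ => 0, []) =
        (initList (T.machine M.tm M.outputAlphabet) (u.map M.inputAlphabet.invFun)).stk := by
      rw [initList_stk]
      exact (T.update_contents_inl _ 0 _ _ _).symm.trans
        ((congrArg (fun S : ∀ k, List (T.stackSym M.tm k) =>
          Function.update S (Sum.inl M.tm.k₀) (u.map M.inputAlphabet.invFun)) hempty).trans
            (initList_stk (T.machine M.tm M.outputAlphabet) _).symm)
    exact congrArg (TM2.Cfg.mk _ _) hs
  -- Here the counters must be back at `0`: when the machine halts, all stacks but the output are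
  -- empty.
  have hhalt : (⟨none, (M.tm.initialState, none, false),
      T.contents M.tm (fun _ => []) 0 (fun _ => 0, o)⟩ :
        TM2.Cfg (T.stackSym M.tm) (M.tm.Λ ⊕ T.Label) (Transducer.State M.tm I)) =
      haltList (T.machine M.tm M.outputAlphabet) o := by
    have hs : T.contents M.tm (fun _ => []) 0 (fun _ => 0, o) =
        (haltList (T.machine M.tm M.outputAlphabet) o).stk := by
      exact (T.update_contents_out _ 0 (fun _ => 0, []) o).symm.trans
        ((congrArg (fun S : ∀ k, List (T.stackSym M.tm k) =>
          Function.update S (Sum.inr none) o) hempty).trans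
            (haltList_stk (T.machine M.tm M.outputAlphabet) o).symm)
    exact congrArg (TM2.Cfg.mk _ _) hs
  rw [hinit, hhalt] at h₃
  have hmap : o.map (Equiv.refl O).invFun = o := List.map_id o
  have h₄ : Nonempty (TM2OutputsInTime (T.machine M.tm M.outputAlphabet)
    (u.map M.inputAlphabet.invFun) (some o) _) := h₃
  rw [← hmap] at h₄
  exact h₄

/-! ## The transducer from circuits to programs -/

namespace CircuitTransducer

/-- The counters: the weight, the number of nodes, the argument that is being read, and the number of
instructions. -/
inductive Counter where
  | weight | node | arg | time
  deriving DecidableEq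

instance : Fintype Counter where
  elems := {.weight, .node, .arg, .time}
  complete s := by cases s <;> decide

/-- The values of the counters. -/
def counts (k n a t : ℕ) : Counter → ℕ
  | .weight => k
  | .node => n
  | .arg => a
  | .time => t

/-- A number that is written by the transducer: a constant, added to the value of a counter. -/
abbrev Num : Type := Option Counter × ℕ

/-- The value of a number. -/
def Num.val (e : Counter → ℕ) (x : Num) : ℕ := x.1.elim 0 e + x.2

/-- A constant. -/
abbrev lit (n : ℕ) : Num := (none, n)

/-- The sum of a counter and a constant. -/
abbrev count (c : Counter) (n : ℕ) : Num := (some c, n)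

/-- Words written by the transducer: symbols, and counters in unary. -/
abbrev Token : Type := Program.Sym ⊕ Counter

/-- The instruction that writes a token. -/
def Token.instr : Token → Instr (Option Program.Sym) Counter
  | .inl s => .put (some s)
  | .inr c => .putCount c (some .one)

/-- The word for a token. -/
def Token.word (e : Counter → ℕ) : Token → List Program.Sym
  | .inl s => [s]
  | .inr c => List.replicate (e c) .one

/-- The tokens of a number. -/
def Num.tokens (x : Num) : List Token :=
  (x.1.elim [] fun c => [.inr c]) ++ List.replicate x.2 (.inl .one)

theorem Num.word_tokens (e : Counter → ℕ) (x : Num) :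
    x.tokens.flatMap (Token.word e) = List.replicate (x.val e) .one := by
  have h : ∀ n, (List.replicate n (.inl .one : Token)).flatMap (Token.word e) =
      List.replicate n .one := by
    intro n
    induction n with
    | zero => rfl
    | succ n ih => rw [List.replicate_succ, List.flatMap_cons, ih]; rfl
  obtain ⟨_ | c, n⟩ := x
  · simp [tokens, val, h]
  · simp [tokens, val, h, Token.word]

/-- Guarded actions whose variables and values depend on the counters. -/
structure Scheme where
  guards : List (Num × Num)
  writes : List (Num × Num)

namespace Scheme

/-- The action, for given values of the counters. -/
def action (e : Counter → ℕ) (a : Scheme) : Action :=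
  ⟨a.guards.map fun p => (p.1.val e, p.2.val e), a.writes.map fun p => (p.1.val e, p.2.val e)⟩

/-- The scheme of the action that makes the guards true. -/
def release (a : Scheme) : Scheme := ⟨[(lit 0, lit 1)], a.guards⟩

/-- The tokens of the thread of the action. -/
def tokens (a : Scheme) : List Token :=
  .inl .thr ::
    (a.guards.flatMap (fun p => .inl .rd :: (p.1.tokens ++ .inl .sep :: p.2.tokens)) ++
      a.writes.flatMap fun p => .inl .wr :: (p.1.tokens ++ .inl .sep :: p.2.tokens))

theorem word_tokens (e : Counter → ℕ) (a : Scheme) :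
    a.tokens.flatMap (Token.word e) = Program.encodeThreads [(a.action e).thread] := by
  have hr : ∀ l : List (Num × Num),
      (l.flatMap fun p => (.inl .rd :: (p.1.tokens ++ .inl .sep :: p.2.tokens) : List Token)).flatMap
        (Token.word e) = ((l.map fun p => (p.1.val e, p.2.val e)).map
          fun p => Op.read p.1 p.2).flatMap Program.encodeOp := by
    intro l
    induction l with
    | nil => rfl
    | cons p l ih =>
      simp only [List.flatMap_cons, List.flatMap_append, List.map_cons, ih, Num.word_tokens]
      simp [Token.word, Program.encodeOp]
  have hw : ∀ l : List (Num × Num),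
      (l.flatMap fun p => (.inl .wr :: (p.1.tokens ++ .inl .sep :: p.2.tokens) : List Token)).flatMap
        (Token.word e) = ((l.map fun p => (p.1.val e, p.2.val e)).map
          fun p => Op.write p.1 p.2).flatMap Program.encodeOp := by
    intro l
    induction l with
    | nil => rfl
    | cons p l ih =>
      simp only [List.flatMap_cons, List.flatMap_append, List.map_cons, ih, Num.word_tokens]
      simp [Token.word, Program.encodeOp]
  simp only [tokens, List.flatMap_cons, List.flatMap_append, hr, hw, Program.encodeThreads,
    Action.thread, action, List.flatMap_nil, List.append_nil]
  simp [Token.word]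

/-- The instructions that write the thread of the action. -/
def emit (a : Scheme) : List (Instr (Option Program.Sym) Counter) :=
  (a.tokens.map Token.instr).reverse

/-- The instructions that write the threads of the actions and of those that make their guards
true. -/
def emitAll (l : List Scheme) : List (Instr (Option Program.Sym) Counter) :=
  l.flatMap fun a => a.release.emit ++ a.emit

end Scheme

/-- The output for a list of actions. -/
def output (L : List Action) : List (Option Program.Sym) :=
  (Program.encodeThreads (L.map Action.thread)).map some

/-- The output for the actions of a list, written one after the other, and those that make their
guards true. -/
def outputAll (L : List Action) : List (Option Program.Sym) :=
  output (L.reverse.flatMap fun a => [a, a.release])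

theorem evalAll_append {O C : Type} [DecidableEq C] (l l' : List (Instr O C))
    (x : (C → ℕ) × List O) :
    Instr.evalAll (l ++ l') x = Instr.evalAll l' (Instr.evalAll l x) := by
  simp [Instr.evalAll]

/-- The output grows at its front, so executing the token instructions in reverse order yields the
word in the right order. -/
theorem evalAll_emit (a : Scheme) (e : Counter → ℕ) (L : List Action) :
    Instr.evalAll a.emit (e, output L) = (e, output (a.action e :: L)) := by
  have h : ∀ (l : List Token) (o : List (Option Program.Sym)),
      Instr.evalAll (l.map Token.instr).reverse (e, o) =
        (e, (l.flatMap (Token.word e)).map some ++ o) := by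
    intro l
    induction l with
    | nil => intro o; rfl
    | cons s l ih =>
      intro o
      rw [List.map_cons, List.reverse_cons, evalAll_append, ih]
      cases s <;> simp [Instr.evalAll, Instr.eval, Token.instr, Token.word]
  rw [Scheme.emit, h, Scheme.word_tokens]
  simp [output, Program.encodeThreads]

/-- The release is written first and hence stands behind its action, as in `Action.program`;
successive schemes come out in reverse order. -/
theorem evalAll_emitAll (l : List Scheme) (e : Counter → ℕ) (L : List Action) :
    Instr.evalAll (Scheme.emitAll l) (e, outputAll L) =
      (e, outputAll (L ++ l.map (Scheme.action e))) := by
  induction l generalizing L with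
  | nil => simp [Scheme.emitAll, Instr.evalAll]
  | cons a l ih =>
    have h : Scheme.emitAll (a :: l) = a.release.emit ++ (a.emit ++ Scheme.emitAll l) := by
      simp [Scheme.emitAll]
    have h' : output (a.action e :: a.release.action e ::
        L.reverse.flatMap fun a => [a, a.release]) = outputAll (L ++ [a.action e]) := by
      have hrel : a.release.action e = (a.action e).release := by
        simp [Scheme.action, Scheme.release, Action.release, Num.val]
      simp [outputAll, hrel]
    rw [h, evalAll_append, evalAll_append, outputAll, evalAll_emit, evalAll_emit, h', ih]
    simp

/-- The scheme of the action that counts a guess. -/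
def slotScheme : Scheme :=
  ⟨[(lit 2, lit 1), (lit 3, count .weight 0)], [(lit 2, lit 0), (lit 3, count .weight 1)]⟩

/-- The schemes for an input node. -/
def chooseSchemes : List Scheme :=
  [⟨[(lit 1, count .time 0)], [(count .node 4, lit 0), (lit 1, count .time 1)]⟩,
    ⟨[(lit 1, count .time 0), (lit 2, lit 0)],
      [(count .node 4, lit 1), (lit 2, lit 1), (lit 1, count .time 1)]⟩]

/-- The scheme for the default value of a gate. -/
def setSchemes (b : Bool) : List Scheme :=
  [⟨[(lit 1, count .time 0)], [(count .node 4, lit b.toNat), (lit 1, count .time 1)]⟩]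

/-- The schemes for an argument of the last gate. -/
def testSchemes (v b : Bool) : List Scheme :=
  [⟨[(lit 1, count .time 0), (count .arg 4, lit v.toNat)],
      -- The counter `node` has already been incremented for the current gate, so the variable of
      -- the gate is `node + 3` rather than `node + 4`.
      [(count .node 3, lit b.toNat), (lit 1, count .time 1)]⟩,
    ⟨[(lit 1, count .time 0), (count .arg 4, lit (!v).toNat)], [(lit 1, count .time 1)]⟩]

/-- The scheme of the action that checks the result. -/
def checkScheme : Scheme :=
  ⟨[(lit 1, count .time 0), (count .arg 4, lit 1), (lit 2, lit 0), (lit 3, count .weight 0)],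
    [(lit 0, lit 1)]⟩

/-- The scheme of the initial action. -/
def initScheme : Scheme := ⟨[], [(lit 1, lit 0), (lit 2, lit 0), (lit 3, lit 0)]⟩

/-- The states: the default value and the trigger of the last gate, and whether an argument of it is
being read. -/
abbrev St : Type := Bool × Bool × Bool

/-- The instructions for the argument that has been read. -/
def flush (q : St) : List (Instr (Option Program.Sym) Counter) :=
  if q.2.2 then Scheme.emitAll (testSchemes q.2.1 (!q.1)) ++ [.inc .time, .clear .arg] else []

/-- The instructions for the beginning of a gate. -/
def header (b : Bool) : List (Instr (Option Program.Sym) Counter) :=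
  Scheme.emitAll (setSchemes b) ++ [.inc .node, .inc .time]

/-- The next state. -/
def next (q : St) : Option Circuit.Sym → St
  | some .arg => (q.1, q.2.1, true)
  -- The single argument of a negation follows without a symbol `arg`, so its reading begins at
  -- once.
  | some .neg => (true, true, true)
  | some .conj => (true, false, false)
  | some .disj => (false, true, false)
  | some .out => (q.1, q.2.1, false)
  | _ => q

/-- The instructions for a symbol, and for the end of the input. -/
def block (q : St) : Option (Option Circuit.Sym) → List (Instr (Option Program.Sym) Counter)
  -- What is written last comes first in the program: the initial thread, then the check. At this
  -- point `arg` holds the output node and `time` the number of instructions.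
  | none => checkScheme.emit ++ (initScheme.emit ++
      [.clear .weight, .clear .node, .clear .arg, .clear .time])
  | some none => Scheme.emitAll [slotScheme] ++ [.inc .weight]
  | some (some .inp) => Scheme.emitAll chooseSchemes ++ [.inc .node, .inc .time]
  | some (some .one) => [.inc .arg]
  | some (some .arg) => flush q
  | some (some .neg) => flush q ++ header true
  | some (some .conj) => flush q ++ header true
  | some (some .disj) => flush q ++ header false
  | some (some .out) => flush q

/-- The transducer that writes the program of a circuit. -/
def transducer : Transducer (Option Circuit.Sym) (Option Program.Sym) where
  Q := St
  start := (false, false, false)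
  C := Counter
  next := next
  block := block

/-- The effect of the transducer on the counters and the output. -/
def eval (w : List (Option Circuit.Sym)) (q : St)
    (x : (Counter → ℕ) × List (Option Program.Sym)) : (Counter → ℕ) × List (Option Program.Sym) :=
  transducer.eval w q x

/-! ### The run of the transducer on the word of a circuit. -/

theorem eval_nil (q : St) (x : (Counter → ℕ) × List (Option Program.Sym)) :
    eval [] q x = Instr.evalAll (block q none) x := rfl

theorem eval_cons (a : Option Circuit.Sym) (w : List (Option Circuit.Sym)) (q : St)
    (x : (Counter → ℕ) × List (Option Program.Sym)) :
    eval (a :: w) q x = eval w (next q a) (Instr.evalAll (block q (some a)) x) := rfl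

theorem update_counts_weight (k n a t k' : ℕ) :
    Function.update (counts k n a t) .weight k' = counts k' n a t := by
  funext c; cases c <;> rfl

theorem update_counts_node (k n a t n' : ℕ) :
    Function.update (counts k n a t) .node n' = counts k n' a t := by
  funext c; cases c <;> rfl

theorem update_counts_arg (k n a t a' : ℕ) :
    Function.update (counts k n a t) .arg a' = counts k n a' t := by
  funext c; cases c <;> rfl

theorem update_counts_time (k n a t t' : ℕ) :
    Function.update (counts k n a t) .time t' = counts k n a t' := by
  funext c; cases c <;> rfl

theorem evalAll_nil {O C : Type} [DecidableEq C] (x : (C → ℕ) × List O) :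
    Instr.evalAll [] x = x := rfl

theorem evalAll_inc_cons {O C : Type} [DecidableEq C] (c : C) (l : List (Instr O C))
    (e : C → ℕ) (o : List O) :
    Instr.evalAll (.inc c :: l) (e, o) = Instr.evalAll l (Function.update e c (e c + 1), o) := rfl

theorem evalAll_clear_cons {O C : Type} [DecidableEq C] (c : C) (l : List (Instr O C))
    (e : C → ℕ) (o : List O) :
    Instr.evalAll (.clear c :: l) (e, o) = Instr.evalAll l (Function.update e c 0, o) := rfl

theorem evalAll_flush (b v : Bool) (k n a t : ℕ) (L : List Action) :
    Instr.evalAll (flush (b, v, true)) (counts k (n + 1) a t, outputAll L) =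
      (counts k (n + 1) 0 (t + 1), outputAll (L ++ (Micro.test a v n (!b)).acts t)) := by
  have h : (testSchemes v (!b)).map (Scheme.action (counts k (n + 1) a t)) =
      (Micro.test a v n (!b)).acts t := by
    simp [testSchemes, Scheme.action, Micro.acts, Num.val, counts]
  rw [flush, if_pos rfl, evalAll_append, evalAll_emitAll, h, evalAll_inc_cons, evalAll_clear_cons,
    update_counts_time, update_counts_arg]
  rfl

theorem evalAll_header (b : Bool) (k n a t : ℕ) (L : List Action) :
    Instr.evalAll (header b) (counts k n a t, outputAll L) =
      (counts k (n + 1) a (t + 1), outputAll (L ++ (Micro.set n b).acts t)) := by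
  have h : (setSchemes b).map (Scheme.action (counts k n a t)) = (Micro.set n b).acts t := by
    simp [setSchemes, Scheme.action, Micro.acts, Num.val, counts]
  rw [header, evalAll_append, evalAll_emitAll, h, evalAll_inc_cons, evalAll_inc_cons,
    update_counts_node, update_counts_time]
  rfl

/-- The weight precedes the circuit in unary, so the counter passes through all values that need a
slot and ends with the value needed for the check. -/
theorem eval_weight (j k : ℕ) (w : List (Option Circuit.Sym)) (q : St) :
    eval (List.replicate j none ++ w) q
        (counts k 0 0 0, outputAll ((List.range k).map Micro.slot)) =
      eval w q
        (counts (k + j) 0 0 0, outputAll ((List.range (k + j)).map Micro.slot)) := by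
  induction j generalizing k with
  | zero => rfl
  | succ j ih =>
    have h : Instr.evalAll (block q (some none))
        (counts k 0 0 0, outputAll ((List.range k).map Micro.slot)) =
        (counts (k + 1) 0 0 0, outputAll ((List.range (k + 1)).map Micro.slot)) := by
      change Instr.evalAll (Scheme.emitAll [slotScheme] ++ [.inc .weight]) _ = _
      have hs : [slotScheme].map (Scheme.action (counts k 0 0 0)) = [Micro.slot k] := by
        simp [slotScheme, Scheme.action, Micro.slot, Num.val, counts]
      rw [evalAll_append, evalAll_emitAll, hs, evalAll_inc_cons, update_counts_weight,
        List.range_succ, List.map_append]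
      rfl
    rw [List.replicate_succ, List.cons_append, eval_cons, h,
      show k + (j + 1) = k + 1 + j by omega]
    exact ih (k + 1)

theorem eval_inputs (j k n t : ℕ) (L : List Action) (w : List (Option Circuit.Sym)) (q : St) :
    eval (List.replicate j (some .inp) ++ w) q (counts k n 0 t, outputAll L) =
      eval w q (counts k (n + j) 0 (t + j),
        outputAll (L ++ Micro.actsFrom t ((List.range' n j).map .choose))) := by
  induction j generalizing n t L with
  | zero => simp [Micro.actsFrom]
  | succ j ih =>
    have h : Instr.evalAll (block q (some (some .inp))) (counts k n 0 t, outputAll L) =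
        (counts k (n + 1) 0 (t + 1), outputAll (L ++ (Micro.choose n).acts t)) := by
      change Instr.evalAll (Scheme.emitAll chooseSchemes ++ [.inc .node, .inc .time]) _ = _
      have hs : chooseSchemes.map (Scheme.action (counts k n 0 t)) = (Micro.choose n).acts t := by
        simp [chooseSchemes, Scheme.action, Micro.acts, Num.val, counts]
      rw [evalAll_append, evalAll_emitAll, hs, evalAll_inc_cons, evalAll_inc_cons,
        update_counts_node, update_counts_time]
      rfl
    rw [List.replicate_succ, List.cons_append, eval_cons, h]
    refine (ih (n + 1) (t + 1) _).trans ?_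
    rw [List.range'_succ, List.map_cons, Micro.actsFrom, List.append_assoc,
      show n + 1 + j = n + (j + 1) by omega, show t + 1 + j = t + (j + 1) by omega]

theorem eval_ones (j k n a t : ℕ) (o : List (Option Program.Sym)) (w : List (Option Circuit.Sym))
    (q : St) :
    eval (List.replicate j (some .one) ++ w) q (counts k n a t, o) =
      eval w q (counts k n (a + j) t, o) := by
  induction j generalizing a with
  | zero => rfl
  | succ j ih =>
    have h : Instr.evalAll (block q (some (some .one))) (counts k n a t, o) =
        (counts k n (a + 1) t, o) := by
      change Instr.evalAll [.inc Counter.arg] _ = _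
      rw [evalAll_inc_cons, update_counts_arg]
      rfl
    rw [List.replicate_succ, List.cons_append, eval_cons, h,
      show a + (j + 1) = a + 1 + j by omega]
    exact ih (a + 1)

/-- The word starts with a symbol that ends an argument. -/
def EndsArg (w : List (Option Circuit.Sym)) : Prop :=
  ∃ s w', w = some s :: w' ∧ s ≠ .one ∧ s ≠ .inp

/-- The end of a unary argument shows only at the next symbol. Each symbol that can follow begins
its block with `flush` and leads to the same state whether or not an argument was pending, so the
flush may be advanced. -/
theorem eval_flush {w : List (Option Circuit.Sym)} (hw : EndsArg w) (b v : Bool) (k n a t : ℕ)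
    (L : List Action) :
    eval w (b, v, true) (counts k (n + 1) a t, outputAll L) =
      eval w (b, v, false)
        (counts k (n + 1) 0 (t + 1), outputAll (L ++ (Micro.test a v n (!b)).acts t)) := by
  obtain ⟨s, w, rfl, h1, h2⟩ := hw
  rw [eval_cons, eval_cons, ← evalAll_flush]
  cases s with
  | one => exact absurd rfl h1
  | inp => exact absurd rfl h2
  | arg => rfl
  | out => rfl
  | neg | conj | disj =>
    refine congrArg (eval w _) ?_
    exact evalAll_append _ _ _

/-- That the remaining word ends an argument is carried through the induction, since flushing one
argument depends on what follows it. -/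
theorem eval_args (l : List ℕ) {w : List (Option Circuit.Sym)} (hw : EndsArg w) (b v : Bool)
    (k n t : ℕ) (L : List Action) :
    EndsArg ((l.flatMap fun i => .arg :: List.replicate i .one).map some ++ w) ∧
    eval ((l.flatMap fun i => .arg :: List.replicate i .one).map some ++ w)
        (b, v, false) (counts k (n + 1) 0 t, outputAll L) =
      eval w (b, v, false) (counts k (n + 1) 0 (t + l.length),
        outputAll (L ++ Micro.actsFrom t (l.map fun i => .test i v n (!b)))) := by
  induction l generalizing t L with
  | nil => exact ⟨hw, by simp [Micro.actsFrom]⟩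
  | cons i l ih =>
    have hw' := fun t L => (ih t L).1
    have heq : ((i :: l).flatMap fun i => Circuit.Sym.arg :: List.replicate i .one).map some ++ w =
        some .arg :: (List.replicate i (some .one) ++
          ((l.flatMap fun i => Circuit.Sym.arg :: List.replicate i .one).map some ++ w)) := by
      simp
    refine ⟨⟨_, _, heq, by simp, by simp⟩, ?_⟩
    rw [heq, eval_cons]
    refine (eval_ones i k (n + 1) 0 t _ _ (b, v, true)).trans ?_
    rw [eval_flush (hw' t L), (ih _ _).2, zero_add, List.map_cons, Micro.actsFrom,
      List.append_assoc, List.length_cons, show t + 1 + l.length = t + (l.length + 1) by omega]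

theorem eval_gate (g : Gate) {w : List (Option Circuit.Sym)} (hw : EndsArg w) (b v : Bool)
    (k n t : ℕ) (L : List Action) :
    EndsArg ((Circuit.encodeGate g).map some ++ w) ∧
    eval ((Circuit.encodeGate g).map some ++ w) (b, v, false)
        (counts k n 0 t, outputAll L) =
      eval w (g.default, g.trigger, false) (counts k (n + 1) 0 (t + (g.micros n).length),
        outputAll (L ++ Micro.actsFrom t (g.micros n))) := by
  cases g with
  | neg i =>
    have heq : (Circuit.encodeGate (.neg i)).map some ++ w =
        some .neg :: (List.replicate i (some .one) ++ w) := by simp [Circuit.encodeGate]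
    refine ⟨⟨_, _, heq, by simp, by simp⟩, ?_⟩
    rw [heq, eval_cons]
    have h : Instr.evalAll (block (b, v, false) (some (some .neg)))
      (counts k n 0 t, outputAll L) = _ := evalAll_header true k n 0 t L
    rw [h]
    refine (eval_ones i k (n + 1) 0 (t + 1) _ _ (true, true, true)).trans ?_
    rw [eval_flush hw]
    simp [Gate.micros, Gate.default, Gate.trigger, Gate.args, Micro.actsFrom]
  | conj l =>
    have heq : (Circuit.encodeGate (.conj l)).map some ++ w =
        some .conj :: ((l.flatMap fun i => .arg :: List.replicate i .one).map some ++ w) := by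
      simp [Circuit.encodeGate]
    refine ⟨⟨_, _, heq, by simp, by simp⟩, ?_⟩
    rw [heq, eval_cons]
    have h : Instr.evalAll (block (b, v, false) (some (some .conj)))
      (counts k n 0 t, outputAll L) = _ := evalAll_header true k n 0 t L
    rw [h]
    refine (eval_args l hw true false k n (t + 1) _).2.trans ?_
    simp [Gate.micros, Gate.default, Gate.trigger, Gate.args, Micro.actsFrom, add_assoc,
      add_comm 1]
  | disj l =>
    have heq : (Circuit.encodeGate (.disj l)).map some ++ w =
        some .disj :: ((l.flatMap fun i => .arg :: List.replicate i .one).map some ++ w) := by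
      simp [Circuit.encodeGate]
    refine ⟨⟨_, _, heq, by simp, by simp⟩, ?_⟩
    rw [heq, eval_cons]
    have h : Instr.evalAll (block (b, v, false) (some (some .disj)))
      (counts k n 0 t, outputAll L) = _ := evalAll_header false k n 0 t L
    rw [h]
    refine (eval_args l hw false true k n (t + 1) _).2.trans ?_
    simp [Gate.micros, Gate.default, Gate.trigger, Gate.args, Micro.actsFrom, add_assoc,
      add_comm 1]

/-- The final flags `b'` and `v'` depend on the last gate; they no longer matter, as no argument is
pending. -/
theorem eval_gates (gs : List Gate) {w : List (Option Circuit.Sym)} (hw : EndsArg w) (b v : Bool)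
    (k n t : ℕ) (L : List Action) :
    EndsArg ((gs.flatMap Circuit.encodeGate).map some ++ w) ∧
    ∃ b' v', eval ((gs.flatMap Circuit.encodeGate).map some ++ w) (b, v, false)
        (counts k n 0 t, outputAll L) =
      eval w (b', v', false)
        (counts k (n + gs.length) 0 (t + (gatesMicros n gs).length),
          outputAll (L ++ Micro.actsFrom t (gatesMicros n gs))) := by
  induction gs generalizing b v n t L with
  | nil => exact ⟨hw, b, v, by simp [gatesMicros, Micro.actsFrom]⟩
  | cons g gs ih =>
    have hw' := (ih b v n t L).1
    rw [List.flatMap_cons, List.map_append, List.append_assoc]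
    obtain ⟨h1, h2⟩ := eval_gate g hw' b v k n t L
    refine ⟨h1, ?_⟩
    obtain ⟨-, b', v', h3⟩ := ih g.default g.trigger (n + 1) (t + (g.micros n).length)
      (L ++ Micro.actsFrom t (g.micros n))
    refine ⟨b', v', ?_⟩
    rw [h2, h3, gatesMicros, Micro.actsFrom_append, List.length_append, List.append_assoc,
      List.length_cons, show n + 1 + gs.length = n + (gs.length + 1) by omega, add_assoc]

/-- The transducer writes the program of a circuit. -/
theorem eval_encode (C : Circuit) (k : ℕ) :
    eval (List.replicate k none ++ C.encode.map some) (false, false, false) (fun _ => 0, []) =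
      (fun _ => 0, (Program.encodeThreads (C.program k).1).map some) := by
  have hstart : ((fun _ => 0, []) : (Counter → ℕ) × List (Option Program.Sym)) =
      (counts 0 0 0 0, outputAll ((List.range 0).map Micro.slot)) := by
    refine Prod.ext ?_ rfl
    funext c
    cases c <;> rfl
  have hword : C.encode.map some = List.replicate C.inputs (some .inp) ++
      ((C.gates.flatMap Circuit.encodeGate).map some ++
        some .out :: (List.replicate C.out (some .one) ++ [])) := by
    simp [Circuit.encode]
  obtain ⟨-, b, v, h⟩ := eval_gates C.gates
    (w := some .out :: (List.replicate C.out (some .one) ++ [])) ⟨_, _, rfl, by simp, by simp⟩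
    false false k C.inputs C.inputs
    ((List.range k).map Micro.slot ++ Micro.actsFrom 0 ((List.range C.inputs).map .choose))
  have hacts : (List.range k).map Micro.slot ++
      Micro.actsFrom 0 ((List.range C.inputs).map .choose) ++
      Micro.actsFrom C.inputs (gatesMicros C.inputs C.gates) = C.acts k := by
    rw [Circuit.acts, Circuit.micros, Micro.actsFrom_append, List.append_assoc]
    simp
  have hlen : C.inputs + (gatesMicros C.inputs C.gates).length = C.micros.length := by
    simp [Circuit.micros]
  rw [hacts, hlen] at h
  have hfinal : Instr.evalAll (block (b, v, false) none)
      (counts k (C.inputs + C.gates.length) C.out C.micros.length, outputAll (C.acts k)) =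
      (fun _ => 0, (Program.encodeThreads (C.program k).1).map some) := by
    rw [block, evalAll_append, evalAll_append, outputAll, evalAll_emit, evalAll_emit,
      evalAll_clear_cons, evalAll_clear_cons, evalAll_clear_cons, evalAll_clear_cons,
      update_counts_weight, update_counts_node, update_counts_arg, update_counts_time, evalAll_nil]
    refine Prod.ext ?_ ?_
    · funext c
      cases c <;> rfl
    · have hinit : ∀ e, initScheme.action e = ⟨[], [(1, 0), (2, 0), (3, 0)]⟩ := by
        intro e
        simp [initScheme, Scheme.action, Num.val]
      have hcheck : ∀ n, checkScheme.action (counts k n C.out C.micros.length) =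
          ⟨[(1, C.micros.length), (C.out + 4, 1), (2, 0), (3, k)], [(0, 1)]⟩ := by
        intro n
        simp [checkScheme, Scheme.action, Num.val, counts]
      rw [hinit, hcheck]
      rfl
  have hflush : Instr.evalAll (block (b, v, false) (some (some .out)))
      (counts k (C.inputs + C.gates.length) 0 C.micros.length, outputAll (C.acts k)) =
      (counts k (C.inputs + C.gates.length) 0 C.micros.length, outputAll (C.acts k)) := rfl
  rw [hstart, hword, eval_weight, eval_inputs, zero_add, zero_add, ← List.range_eq_range', h,
    eval_cons, hflush, eval_ones, eval_nil, zero_add]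
  exact hfinal

end CircuitTransducer

/-! ## Hardness -/

/-- The problem is hard for the class `W[1]`. The reduction has the value `0` of the parameter:
already the order of the threads, each of which runs in one go, can encode the choice of an
assignment and the evaluation of a circuit. -/
theorem wHard_vsc : WHard 1 vsc := by
  rintro A ⟨d, R, K, f, g, c, M, hf, hg, hyes, hK, hM⟩
  have : Fintype (weightedCircuitSat 1 d).Sym := (weightedCircuitSat 1 d).symFintype
  obtain ⟨M', D, hM'⟩ := exists_machine_transducer M CircuitTransducer.transducer
  -- Both `k + |x| + 1`, where `k` is due to the unary parameter, and the time of `M` are at most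
  -- `(f k + k + 1) * (|x| + 1) ^ (c + 1)`. Squaring twice this quantity gives the factor `4` and
  -- the exponent `2 * (c + 1)`.
  refine ⟨fun x k => (R x k).1.program (K x k), fun _ _ => 0,
    fun k => 4 * D * ((f k + k + 1) * (f k + k + 1)), fun _ => 0, 2 * (c + 1), M', ?_,
    Computable.const 0, fun x k => ?_, fun _ _ => le_rfl, fun x k => ?_⟩
  · have h1 : Computable fun k => f k + k + 1 :=
      Computable.succ.comp (Primrec.nat_add.to_comp.comp hf Computable.id)
    exact Primrec.nat_mul.to_comp.comp (Computable.const (4 * D))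
      (Primrec.nat_mul.to_comp.comp h1 h1)
  · rw [hyes]
    exact Circuit.weightedSat_iff_vsc (R x k).2.1 (K x k)
  -- With parameter `0` the word of the image has no unary prefix: it is exactly the encoded
  -- program.
  · obtain ⟨h⟩ := hM' (A.word x k) _ _ _ (hM x k)
      (CircuitTransducer.eval_encode (R x k).1 (K x k))
    refine ⟨⟨h.toEvalsTo, h.steps_le_m.trans ?_⟩⟩
    have hlen : (A.word x k).length = k + A.size x := by
      simp [ParamProblem.word, ParamProblem.size]
    rw [hlen]
    have hX : A.size x + 1 ≤ (A.size x + 1) ^ (c + 1) := Nat.le_self_pow (by omega) _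
    have hX' : (A.size x + 1) ^ c ≤ (A.size x + 1) ^ (c + 1) :=
      Nat.pow_le_pow_right (by omega) (by omega)
    rw [mul_comm 2, pow_mul]
    generalize (A.size x + 1) ^ (c + 1) = X at hX hX' ⊢
    have h1 : k + A.size x + 1 ≤ (f k + k + 1) * X := by
      calc k + A.size x + 1 ≤ (k + 1) * (A.size x + 1) := by nlinarith
        _ ≤ _ := Nat.mul_le_mul (by omega) hX
    have h2 : f k * (A.size x + 1) ^ c ≤ (f k + k + 1) * X := Nat.mul_le_mul (by omega) hX'
    calc D * (k + A.size x + f k * (A.size x + 1) ^ c + 1) ^ 2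
        ≤ D * (2 * ((f k + k + 1) * X)) ^ 2 := by gcongr; omega
      _ = _ := by ring

end ParamComplexity

theorem theorem4 : ParamComplexity.WHard 1 ParamComplexity.vsc := by
  exact ParamComplexity.wHard_vsc
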